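/- Let $\varphi$ be a non-constant polynomial with real coefficients. Put $$Q=\Big(\frac{\varphi'}{\varphi}\Big)'=\frac{\varphi\varphi''-(\varphi')^2}{\varphi^2},\qquad Q_1=\Big(\frac{\varphi''}{\varphi'}\Big)'=\frac{\varphi'\varphi'''-(\varphi'')^2}{(\varphi')^2},$$ and for a real rational function $r\not\equiv0$ let $Z_{\mathbb R}(r)$ be the number of real zeros of $r$, counting multiplicities (poles are not zeros). If $\deg\varphi=1$, then $Q_1\equiv0$ and we put $Z_{\mathbb R}(Q_1)=0$. Extra zeros. All zeros are counted with multiplicities. If $a<b$ are consecutive real zeros of $\varphi$ and $\varphi'$ has $2s+1$ zeros in $(a,b)$ (the number is odd by Rolle's theorem), then $\varphi'$ is said to have $2s$ extra zeros between $a$ and $b$. Every zero of $\varphi'$ smaller than the smallest or larger than the largest real zero of $\varphi$ is an extra zero; if $\varphi$ has no real zeros, every real zero of $\varphi'$ is an extra zero. $E(\varphi')$ denotes the total number of extra zeros of $\varphi'$. Property A. Let $\alpha$ be a real zero of $\varphi$. Let $\beta_1$ be the largest zero of $\varphi'$ in $(-\infty,\alpha)$, or $-\infty$ if there is none, and let $\beta_2$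 be the smallest zero of $\varphi'$ in $(\alpha,+\infty)$, or $+\infty$ if there is none. Then $\varphi$ possesses property A at $\alpha$ if $Q$ has no zeros in at least one of the intervals $(\beta_1,\alpha)$ and $(\alpha,\beta_2)$. The polynomial $\varphi$ possesses property A if it does so at each of its real zeros (in particular, if it has no real zeros). Theorem. Suppose that $\varphi$ possesses property A, and let $[x]$ denote the largest integer not exceeding $x$. I. If $\varphi(x)\ne0$ for all $x\in\mathbb R$, then $$2\Big[\frac{E(\varphi')}2\Big]+2\le Z_{\mathbb R}(Q)\le 2\Big[\frac{E(\varphi')}2\Big]+2+Z_{\mathbb R}(Q_1).$$ II. If $\varphi$ has at least one real zero, then $$2\Big[\frac{E(\varphi')}2\Big]\le Z_{\mathbb R}(Q)\le 2\Big[\frac{E(\varphi')}2\Big]+Z_{\mathbb R}(Q_1).$$ -/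

import Mathlib

open Polynomial

noncomputable section

/-- The real zeros of a real rational function, each repeated according to its multiplicity:
the real roots of the numerator of the function in lowest terms (so poles are not zeros). -/
def realZeros (r : RatFunc ℝ) : Multiset ℝ := r.num.roots

/-- `Z_ℝ(r)`: the number of real zeros of `r`, counting multiplicities. -/
def numRealZeros (r : RatFunc ℝ) : ℕ := Multiset.card (realZeros r)

/-- `Q[φ] = (φ φ'' - φ'²) / φ²`, the derivative of the logarithmic derivative `φ' / φ`. -/
def logDerivDeriv (φ : ℝ[X]) : RatFunc ℝ :=
  algebraMap ℝ[X] (RatFunc ℝ) (φ * derivative (derivative φ) - derivative φ ^ 2) /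
    algebraMap ℝ[X] (RatFunc ℝ) (φ ^ 2)

/-- Pairs `(a, b)` of consecutive distinct real zeros `a < b` of `φ`. -/
def consecutiveZeros (φ : ℝ[X]) : Finset (ℝ × ℝ) :=
  open Classical in
  (φ.roots.toFinset ×ˢ φ.roots.toFinset).filter
    (fun ab => ab.1 < ab.2 ∧ ∀ c ∈ φ.roots, ¬ (ab.1 < c ∧ c < ab.2))

/-- `E(φ')`: the number of extra zeros of `φ'`, counting multiplicities. In every interval between
two consecutive real zeros of `φ`, all zeros of `φ'` but one are extra (by Rolle's theorem there is
at least one, so the subtraction is never truncated). All real zeros of `φ'` below the smallest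
or above the largest real zero of `φ` are extra. If `φ` has no real zero, all real zeros of `φ'`
are extra. -/
def numExtraZeros (φ : ℝ[X]) : ℕ :=
  open Classical in
  (∑ ab ∈ consecutiveZeros φ,
      (Multiset.card ((derivative φ).roots.filter (fun x => ab.1 < x ∧ x < ab.2)) - 1)) +
    Multiset.card ((derivative φ).roots.filter
      (fun x => (∀ a ∈ φ.roots, x < a) ∨ (∀ a ∈ φ.roots, a < x)))

/-- `β` is the zero of `φ'` next to `α` on the left, or `-∞` if `φ'` has no zero in `(-∞, α)`. -/
def IsLeftNeighbour (φ : ℝ[X]) (α : ℝ) (β : EReal) : Prop :=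
  (∀ x : ℝ, β < (x : EReal) → x < α → (derivative φ).eval x ≠ 0) ∧
    (β = ⊥ ∨ ∃ b : ℝ, β = (b : EReal) ∧ b < α ∧ (derivative φ).eval b = 0)

/-- `β` is the zero of `φ'` next to `α` on the right, or `+∞` if `φ'` has no zero in `(α, +∞)`. -/
def IsRightNeighbour (φ : ℝ[X]) (α : ℝ) (β : EReal) : Prop :=
  (∀ x : ℝ, α < x → (x : EReal) < β → (derivative φ).eval x ≠ 0) ∧
    (β = ⊤ ∨ ∃ b : ℝ, β = (b : EReal) ∧ α < b ∧ (derivative φ).eval b = 0)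

/-- Property A of `φ` at its real zero `α`: if `β₁ < α < β₂` are the neighbouring zeros of `φ'`
(or `∓∞`), then `Q[φ]` has no zero in at least one of `(β₁, α)` and `(α, β₂)`. -/
def HasPropertyAAt (φ : ℝ[X]) (α : ℝ) : Prop :=
  ∀ β₁ β₂ : EReal, IsLeftNeighbour φ α β₁ → IsRightNeighbour φ α β₂ →
    (∀ x ∈ realZeros (logDerivDeriv φ), ¬ (β₁ < (x : EReal) ∧ x < α)) ∨
    (∀ x ∈ realZeros (logDerivDeriv φ), ¬ (α < x ∧ (x : EReal) < β₂))

/-- Property A: property A at every real zero. -/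
def HasPropertyA (φ : ℝ[X]) : Prop :=
  ∀ α : ℝ, φ.eval α = 0 → HasPropertyAAt φ α

end

open Polynomial

section

open Set Filter Topology

/-! Write N = φφ'' - φ'² and N₁ = φ'φ''' - φ''². At a zero of φ of multiplicity m the order of N is
2m - 2 < 2m, so the zeros of Q are exactly the zeros of N off the zeros of φ
(`realZeros_logDerivDeriv`). Moreover N is negative near each zero of φ and near ±∞, so it has an
even number of zeros in every interval cut out by the zeros of φ. Hence Z(Q) is even, and so is
Z(Q₁) when deg φ > 1. It therefore suffices to prove bounds without integer parts and round them by
parity.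

Lower bound: (φ'/φ)' = N/φ², and Rolle's theorem with multiplicities on an interval free of zeros of
φ gives N at least as many zeros as φ' has, minus one. Every infinite end supplies one further zero
of N beyond the extreme zeros of φ' (`rootCount_derivative_le`). Summation gives Z(Q) ≥ E, and Z(Q)
≥ E + 1 when φ has no real zero.

Upper bound: (N/φ')' = φN₁/φ'². In a gap between zeros of φ' without zeros of φ, Rolle bounds the
zeros of N by those of N₁ plus one. If a zero of φ lies in the gap or at its end, property A
confines the zeros of N to one side of it, so the same bound holds. Both counts are then even, and
the extra one disappears (`Touches.rootCount_logWronskian_le`). Summing over the gaps, and adding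
the zeros of N at zeros of φ', gives `numRealZeros_add_card_le`. Comparison with the definition of E
finishes the proof. -/

/-! ### The polynomial `p p'' - p'²`: orders and signs near roots and at infinity -/

/-- The numerator `p p'' - p'²` of the derivative of `p' / p`. -/
noncomputable def logWronskian (p : ℝ[X]) : ℝ[X] :=
  p * derivative (derivative p) - derivative p ^ 2

/-- Second logarithmic derivatives add under products; this is that identity with denominators
cleared. -/
theorem logWronskian_mul (p q : ℝ[X]) :
    logWronskian (p * q) = logWronskian p * q ^ 2 + p ^ 2 * logWronskian q := by
  simp only [logWronskian, derivative_mul, derivative_add]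
  ring

theorem derivative_comp_neg_X (p : ℝ[X]) :
    derivative (p.comp (-X)) = -(derivative p).comp (-X) := by
  simp [derivative_comp]

theorem logWronskian_comp_neg (p : ℝ[X]) :
    logWronskian (p.comp (-X)) = (logWronskian p).comp (-X) := by
  simp [logWronskian, derivative_comp_neg_X]

theorem logWronskian_X_sub_C_pow (a : ℝ) (k : ℕ) :
    logWronskian ((X - C a) ^ (k + 1)) = -C ((k : ℝ) + 1) * (X - C a) ^ (2 * k) := by
  rcases k with _ | k
  · simp [logWronskian]
  · simp only [logWronskian, derivative_X_sub_C_pow, derivative_mul, derivative_C,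
      Nat.add_sub_cancel]
    push_cast
    simp only [map_add, map_one, map_natCast]
    ring

/-- Split p = (X - a)^(k+1) u: the power contributes -(k+1)(X - a)^(2k) u², and the contribution of
u has order at least 2k + 2. -/
theorem exists_logWronskian_eq {p : ℝ[X]} (hp : p ≠ 0) {a : ℝ} (ha : p.eval a = 0) :
    ∃ (k : ℕ) (v : ℝ[X]), p.rootMultiplicity a = k + 1 ∧ v.eval a < 0 ∧
      logWronskian p = (X - C a) ^ (2 * k) * v := by
  obtain ⟨u, hu, hdvd⟩ := exists_eq_pow_rootMultiplicity_mul_and_not_dvd p hp a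
  have hpos : 0 < p.rootMultiplicity a := (rootMultiplicity_pos hp).2 ha
  obtain ⟨k, hk⟩ : ∃ k, p.rootMultiplicity a = k + 1 := ⟨_, (Nat.succ_pred_eq_of_pos hpos).symm⟩
  have hua : u.eval a ≠ 0 := fun h => hdvd (dvd_iff_isRoot.2 h)
  refine ⟨k, -C ((k : ℝ) + 1) * u ^ 2 + (X - C a) ^ 2 * logWronskian u, hk, ?_, ?_⟩
  · have : 0 < ((k : ℝ) + 1) * u.eval a ^ 2 := by positivity
    simp only [eval_add, eval_mul, eval_neg, eval_C, eval_pow, eval_sub, eval_X]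
    rw [sub_self, zero_pow two_ne_zero, zero_mul, add_zero]
    linarith
  · conv_lhs => rw [hu, hk, logWronskian_mul, logWronskian_X_sub_C_pow]
    ring

theorem logWronskian_neg_near_root {p : ℝ[X]} (hp : p ≠ 0) {a : ℝ} (ha : p.eval a = 0) :
    ∀ᶠ x in 𝓝[≠] a, (logWronskian p).eval x < 0 := by
  obtain ⟨k, v, -, hv, h⟩ := exists_logWronskian_eq hp ha
  have h1 : ∀ᶠ x in 𝓝[≠] a, v.eval x < 0 :=
    nhdsWithin_le_nhds (v.continuous.continuousAt.eventually (gt_mem_nhds hv))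
  filter_upwards [h1, self_mem_nhdsWithin] with x hx hxa
  have hne : x - a ≠ 0 := sub_ne_zero.2 hxa
  have : 0 < (x - a) ^ (2 * k) := by rw [pow_mul]; positivity
  rw [h]
  simpa using mul_neg_of_pos_of_neg this hx

theorem rootMultiplicity_logWronskian_lt {p : ℝ[X]} (hp : p ≠ 0) {a : ℝ} (ha : p.eval a = 0) :
    (logWronskian p).rootMultiplicity a < 2 * p.rootMultiplicity a := by
  obtain ⟨k, v, hk, hv, h⟩ := exists_logWronskian_eq hp ha
  have hv0 : v ≠ 0 := by rintro rfl; simp at hv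
  rw [h, rootMultiplicity_mul (mul_ne_zero (pow_ne_zero _ (X_sub_C_ne_zero a)) hv0),
    rootMultiplicity_X_sub_C_pow, rootMultiplicity_eq_zero (p := v) (fun hr => hv.ne hr), hk]
  omega

/-- With n = k + 1 the degree, the top terms combine to n(n - 1) - n² = -n, which is never zero.
This fixes the degree and the negative sign at infinity. -/
theorem logWronskian_coeff {p : ℝ[X]} {k : ℕ} (hp : p.natDegree = k + 1) :
    (logWronskian p).coeff (2 * k) = -((k : ℝ) + 1) * p.leadingCoeff ^ 2 := by
  have hd : (derivative p).natDegree ≤ k := by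
    have := natDegree_derivative_le p
    omega
  have hdc : (derivative p).coeff k = p.leadingCoeff * (k + 1) := by
    rw [coeff_derivative, leadingCoeff, hp]
  have hdd : (derivative (derivative p)).natDegree ≤ k - 1 := by
    have := natDegree_derivative_le (derivative p)
    omega
  have h2 : (derivative p ^ 2).coeff (2 * k) = (p.leadingCoeff * (k + 1)) ^ 2 := by
    rw [pow_two, two_mul, coeff_mul_add_eq_of_natDegree_le hd hd, hdc, pow_two]
  rw [logWronskian, coeff_sub, h2]
  rcases k with _ | k
  · have : derivative (derivative p) = 0 := by
      rw [eq_C_of_natDegree_le_zero hd, derivative_C]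
    rw [this]
    simp
  · have h1 : 2 * (k + 1) = (k + 1 + 1) + k := by ring
    rw [h1, coeff_mul_add_eq_of_natDegree_le hp.le
      (show (derivative (derivative p)).natDegree ≤ k from hdd), coeff_derivative, hdc,
      leadingCoeff, hp]
    push_cast
    ring

theorem natDegree_logWronskian_le {p : ℝ[X]} {k : ℕ} (hp : p.natDegree = k + 1) :
    (logWronskian p).natDegree ≤ 2 * k := by
  have hd : (derivative p).natDegree ≤ k := by
    have := natDegree_derivative_le p
    omega
  have hdd : (derivative (derivative p)).natDegree ≤ k - 1 := by
    have := natDegree_derivative_le (derivative p)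
    omega
  rw [logWronskian]
  refine (natDegree_sub_le _ _).trans (max_le ?_ ?_)
  · rcases k with _ | k
    · have : derivative (derivative p) = 0 := by
        rw [eq_C_of_natDegree_le_zero hd, derivative_C]
      simp [this]
    · refine natDegree_mul_le.trans ?_
      omega
  · refine natDegree_pow_le.trans ?_
    omega

theorem logWronskian_ne_zero {p : ℝ[X]} (hp : 0 < p.natDegree) : logWronskian p ≠ 0 := by
  obtain ⟨k, hk⟩ : ∃ k, p.natDegree = k + 1 := ⟨_, (Nat.succ_pred_eq_of_pos hp).symm⟩
  intro h
  have h1 := logWronskian_coeff hk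
  have h0 : p.leadingCoeff ≠ 0 := leadingCoeff_ne_zero.2 (by rintro rfl; simp at hp)
  have : 0 < ((k : ℝ) + 1) * p.leadingCoeff ^ 2 := by positivity
  rw [h, coeff_zero] at h1
  linarith

theorem logWronskian_neg_atTop {p : ℝ[X]} (hp : 0 < p.natDegree) :
    ∀ᶠ x in atTop, (logWronskian p).eval x < 0 := by
  obtain ⟨k, hk⟩ : ∃ k, p.natDegree = k + 1 := ⟨_, (Nat.succ_pred_eq_of_pos hp).symm⟩
  have h0 : p.leadingCoeff ≠ 0 := leadingCoeff_ne_zero.2 (by rintro rfl; simp at hp)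
  have hc : (logWronskian p).coeff (2 * k) < 0 := by
    have : 0 < ((k : ℝ) + 1) * p.leadingCoeff ^ 2 := by positivity
    rw [logWronskian_coeff hk]
    linarith
  have hdeg : (logWronskian p).natDegree = 2 * k :=
    natDegree_eq_of_le_of_coeff_ne_zero (natDegree_logWronskian_le hk) hc.ne
  have hlim := div_tendsto_atTop_leadingCoeff_div_of_degree_eq (logWronskian p) (X ^ (2 * k)) (by
    rw [degree_X_pow, degree_eq_natDegree (logWronskian_ne_zero hp), hdeg])
  have hl : (logWronskian p).leadingCoeff / (X ^ (2 * k) : ℝ[X]).leadingCoeff < 0 := by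
    rw [leadingCoeff_X_pow, div_one, leadingCoeff, hdeg]
    exact hc
  filter_upwards [hlim.eventually (gt_mem_nhds hl), eventually_gt_atTop 0] with x hx hx0
  have : 0 < x ^ (2 * k) := by positivity
  rw [eval_pow, eval_X, div_lt_iff₀ this, zero_mul] at hx
  exact hx

theorem natDegree_comp_neg_X (p : ℝ[X]) : (p.comp (-X)).natDegree = p.natDegree := by
  rw [natDegree_comp]
  simp

/-! ### Zeros of Q as roots of a polynomial -/

/-- Compare orders at x in num · φ² = N · denom, where num and denom do not both vanish. If φ(x) ≠
0, the orders of num and N agree; if φ(x) = 0, the order of N is too small to cancel φ², so x is a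
pole. -/
theorem realZeros_logDerivDeriv {φ : ℝ[X]} (hφ : φ ≠ 0) [DecidablePred fun x => φ.eval x ≠ 0] :
    realZeros (logDerivDeriv φ) = (logWronskian φ).roots.filter (fun x => φ.eval x ≠ 0) := by
  classical
  rw [realZeros]
  set r := logDerivDeriv φ with hr
  rcases eq_or_ne (logWronskian φ) 0 with h0 | h0
  · have : r = 0 := by
      rw [hr, logDerivDeriv, ← logWronskian, h0]
      simp
    rw [this, h0]
    simp
  have hφ2 : φ ^ 2 ≠ 0 := pow_ne_zero 2 hφ
  have hrel : r.num * φ ^ 2 = logWronskian φ * r.denom := by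
    rw [← RatFunc.num_div_denom r, logDerivDeriv, div_eq_div_iff] at hr
    · rw [← map_mul, ← map_mul] at hr
      exact RatFunc.algebraMap_injective ℝ hr
    · simpa using r.denom_ne_zero
    · simpa using hφ
  have hn : r.num ≠ 0 := by
    intro h
    rw [h, zero_mul] at hrel
    exact mul_ne_zero h0 r.denom_ne_zero hrel.symm
  have hcop : ∀ x, r.num.rootMultiplicity x = 0 ∨ r.denom.rootMultiplicity x = 0 := by
    intro x
    by_contra! h
    have h1 : r.num.eval x = 0 :=
      (rootMultiplicity_pos hn).1 (Nat.pos_of_ne_zero h.1)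
    have h2 : r.denom.eval x = 0 :=
      (rootMultiplicity_pos r.denom_ne_zero).1 (Nat.pos_of_ne_zero h.2)
    obtain ⟨u, v, huv⟩ := r.isCoprime_num_denom
    have := congrArg (eval x) huv
    simp [h1, h2] at this
  ext x
  rw [Multiset.count_filter, count_roots, count_roots]
  have hmul := congrArg (rootMultiplicity x) hrel
  rw [rootMultiplicity_mul (mul_ne_zero hn hφ2),
    rootMultiplicity_mul (mul_ne_zero h0 r.denom_ne_zero), pow_two,
    rootMultiplicity_mul (mul_ne_zero hφ hφ)] at hmul
  split_ifs with hx
  · have : φ.rootMultiplicity x = 0 := rootMultiplicity_eq_zero hx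
    rcases hcop x with h | h <;> omega
  · have := rootMultiplicity_logWronskian_lt hφ (not_not.1 hx)
    rcases hcop x with h | h <;> omega

/-! ### Counting roots with multiplicity: Rolle and parity -/

open Classical in
/-- The number of roots of `p` in `I`, counted with multiplicity. -/
noncomputable def rootCount (p : ℝ[X]) (I : Set ℝ) : ℕ :=
  Multiset.card (p.roots.filter (· ∈ I))

open Classical in
theorem rootCount_eq_sum (p : ℝ[X]) (I : Set ℝ) :
    rootCount p I = ∑ x ∈ p.roots.toFinset.filter (· ∈ I), p.rootMultiplicity x := by
  rw [rootCount, ← Multiset.toFinset_sum_count_eq, Multiset.toFinset_filter]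
  refine Finset.sum_congr rfl fun x hx => ?_
  rw [Multiset.count_filter_of_pos (Finset.mem_filter.1 hx).2, count_roots]

theorem rootCount_mono (p : ℝ[X]) {I J : Set ℝ} (h : I ⊆ J) : rootCount p I ≤ rootCount p J := by
  classical
  exact Multiset.card_le_card (Multiset.monotone_filter_right _ fun x hx => h hx)

theorem rootCount_mul {p q : ℝ[X]} (h : p * q ≠ 0) (I : Set ℝ) :
    rootCount (p * q) I = rootCount p I + rootCount q I := by
  classical
  rw [rootCount, rootCount, rootCount, roots_mul h, Multiset.filter_add, Multiset.card_add]

theorem rootCount_congr {p : ℝ[X]} {I J : Set ℝ} (h : ∀ x, p.eval x = 0 → (x ∈ I ↔ x ∈ J)) :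
    rootCount p I = rootCount p J := by
  classical
  rw [rootCount, rootCount]
  congr 1
  exact Multiset.filter_congr fun x hx => h x (isRoot_of_mem_roots hx)

theorem rootCount_eq_zero {p : ℝ[X]} {I : Set ℝ} (h : ∀ x ∈ I, p.eval x ≠ 0) :
    rootCount p I = 0 := by
  classical
  rw [rootCount, Multiset.card_eq_zero, Multiset.filter_eq_nil]
  exact fun x hx hI => h x hI (isRoot_of_mem_roots hx)

theorem rootCount_pos {p : ℝ[X]} (hp : p ≠ 0) {I : Set ℝ} {x : ℝ} (hx : x ∈ I)
    (h : p.eval x = 0) : 0 < rootCount p I := by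
  classical
  rw [rootCount, Multiset.card_pos_iff_exists_mem]
  exact ⟨x, Multiset.mem_filter.2 ⟨(mem_roots hp).2 h, hx⟩⟩

theorem rootCount_add_le (p : ℝ[X]) {I J K : Set ℝ} (hIK : I ⊆ K) (hJK : J ⊆ K)
    (hd : Disjoint I J) : rootCount p I + rootCount p J ≤ rootCount p K := by
  classical
  rw [rootCount, rootCount, rootCount, ← Multiset.card_add, Multiset.filter_add_filter]
  have h0 : p.roots.filter (fun x => x ∈ I ∧ x ∈ J) = 0 :=
    Multiset.filter_eq_nil.2 fun x _ hx => disjoint_left.1 hd hx.1 hx.2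
  rw [h0, add_zero]
  exact Multiset.card_le_card
    (Multiset.monotone_filter_right _ fun x hx => hx.elim (fun h => hIK h) (fun h => hJK h))

/-- **Rolle's theorem with multiplicities** for the quotient `p / q`. -/
theorem rootCount_le_rootCount_wronskian {p q : ℝ[X]} {I : Set ℝ} (hI : I.OrdConnected)
    (hq : ∀ x ∈ I, q.eval x ≠ 0) (hW : derivative p * q - p * derivative q ≠ 0) :
    rootCount p I ≤ rootCount (derivative p * q - p * derivative q) I + 1 := by
  classical
  set W := derivative p * q - p * derivative q with hWdef
  have hp : p ≠ 0 := by
    rintro rfl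
    simp [hWdef] at hW
  set S := p.roots.toFinset.filter (· ∈ I)
  set T := W.roots.toFinset.filter (· ∈ I)
  have hS : ∀ x, x ∈ S ↔ p.eval x = 0 ∧ x ∈ I := by
    intro x
    simp [S, hp]
  have hT : ∀ x, x ∈ T ↔ W.eval x = 0 ∧ x ∈ I := by
    intro x
    simp [T, hW]
  have hmult : ∀ x, p.rootMultiplicity x ≤ W.rootMultiplicity x + 1 := by
    intro x
    have h1 : (X - C x) ^ p.rootMultiplicity x ∣ p := pow_rootMultiplicity_dvd p x
    have h2 : (X - C x) ^ (p.rootMultiplicity x - 1) ∣ W :=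
      dvd_sub (dvd_mul_of_dvd_left (pow_sub_one_dvd_derivative_of_pow_dvd h1) _)
        (dvd_mul_of_dvd_left ((pow_dvd_pow _ (Nat.sub_le _ _)).trans h1) _)
    have := (le_rootMultiplicity_iff hW).2 h2
    omega
  -- Each distinct root of p may lose one unit of multiplicity in W. The new roots of W between
  -- consecutive roots of p make up for all of these but one.
  have hcard : S.card ≤ (T \ S).card + 1 := by
    refine Finset.card_le_sdiff_of_interleaved fun x hx y hy hxy _ => ?_
    rw [hS] at hx hy
    have hsub : Icc x y ⊆ I := hI.out hx.2 hy.2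
    have hder : ∀ z ∈ Icc x y, HasDerivAt (fun t => p.eval t / q.eval t)
        (W.eval z / q.eval z ^ 2) z := by
      intro z hz
      have hz0 : W.eval z = (derivative p).eval z * q.eval z - p.eval z * (derivative q).eval z := by
        simp [hWdef]
      rw [hz0]
      exact (p.hasDerivAt z).div (q.hasDerivAt z) (hq z (hsub hz))
    obtain ⟨z, hz, hz0⟩ := exists_hasDerivAt_eq_zero hxy
      (fun z hz => (hder z hz).continuousAt.continuousWithinAt)
      (by simp [hx.1, hy.1]) (fun z hz => hder z (Ioo_subset_Icc_self hz))
    have hzI := hsub (Ioo_subset_Icc_self hz)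
    refine ⟨z, (hT z).2 ⟨?_, hzI⟩, hz.1, hz.2⟩
    simpa [hq z hzI] using hz0
  have hTpos : ∀ x ∈ T \ S, 1 ≤ W.rootMultiplicity x := by
    intro x hx
    exact (rootMultiplicity_pos hW).2 ((hT x).1 (Finset.mem_sdiff.1 hx).1).1
  calc rootCount p I = ∑ x ∈ S, p.rootMultiplicity x := rootCount_eq_sum p I
    _ ≤ ∑ x ∈ S, (W.rootMultiplicity x + 1) := Finset.sum_le_sum fun x _ => hmult x
    _ = ∑ x ∈ S, W.rootMultiplicity x + S.card := by simp [Finset.sum_add_distrib]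
    _ ≤ ∑ x ∈ S, W.rootMultiplicity x + (∑ x ∈ T \ S, W.rootMultiplicity x + 1) := by
        have := Finset.card_nsmul_le_sum _ _ _ hTpos
        simp only [smul_eq_mul, mul_one] at this
        omega
    _ = ∑ x ∈ T ∪ S, W.rootMultiplicity x + 1 := by
        rw [← Finset.sdiff_union_self_eq_union, Finset.sum_union Finset.sdiff_disjoint]
        ring
    _ = ∑ x ∈ T, W.rootMultiplicity x + 1 := by
        congr 1
        refine (Finset.sum_subset Finset.subset_union_left fun x hx hxT => ?_).symm
        have hxS : x ∈ S := (Finset.mem_union.1 hx).resolve_left hxT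
        exact rootMultiplicity_eq_zero fun h => hxT ((hT x).2 ⟨h, ((hS x).1 hxS).2⟩)
    _ = rootCount W I + 1 := by rw [rootCount_eq_sum]

/-- Each root in between flips the sign: a factor X - r contributes (c - r)(d - r) < 0. Induction on
the degree strips such factors until none is left. -/
theorem eval_mul_eval_mul_neg_one_pow_rootCount_pos {c d : ℝ} (hcd : c ≤ d) (p : ℝ[X])
    (hc : p.eval c ≠ 0) (hd : p.eval d ≠ 0) :
    0 < p.eval c * p.eval d * (-1) ^ rootCount p (Ioo c d) := by
  induction hn : p.natDegree generalizing p with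
  | zero =>
    have hz : rootCount p (Ioo c d) = 0 := by
      refine rootCount_eq_zero fun x _ => ?_
      rw [eq_C_of_natDegree_eq_zero hn, eval_C] at hc ⊢
      exact hc
    rw [hz, pow_zero, mul_one]
    rw [eq_C_of_natDegree_eq_zero hn, eval_C] at hc ⊢
    rw [eval_C]
    exact mul_self_pos.2 hc
  | succ n ih =>
    by_cases h : ∃ r ∈ Ioo c d, p.eval r = 0
    · obtain ⟨r, hr, hr0⟩ := h
      obtain ⟨q, rfl⟩ := dvd_iff_isRoot.2 hr0
      have hne : (X - C r) * q ≠ 0 := by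
        rintro h
        simp [h] at hc
      have hq0 : q ≠ 0 := right_ne_zero_of_mul hne
      simp only [eval_mul, eval_sub, eval_X, eval_C] at hc hd ⊢
      have hqn : q.natDegree = n := by
        rw [natDegree_mul (X_sub_C_ne_zero r) hq0, natDegree_X_sub_C] at hn
        omega
      have := ih q (right_ne_zero_of_mul hc) (right_ne_zero_of_mul hd) hqn
      have h1 : rootCount (X - C r) (Ioo c d) = 1 := by
        rw [rootCount, roots_X_sub_C, Multiset.filter_singleton, if_pos hr,
          Multiset.card_singleton]
      rw [rootCount_mul hne, h1, pow_add, pow_one]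
      have h2 : 0 < (r - c) * (d - r) := mul_pos (sub_pos.2 hr.1) (sub_pos.2 hr.2)
      have := mul_pos h2 this
      calc _ < _ := this
        _ = _ := by ring
    · push Not at h
      rw [rootCount_eq_zero h, pow_zero, mul_one]
      by_contra! hneg
      have hneg : p.eval c * p.eval d < 0 := lt_of_le_of_ne hneg (mul_ne_zero hc hd)
      have hcont : ContinuousOn (fun x => p.eval x) (uIcc c d) := p.continuous.continuousOn
      obtain ⟨x, hx, hx0⟩ := intermediate_value_uIcc hcont (show (0 : ℝ) ∈ _ by
        rw [mem_uIcc]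
        rcases mul_neg_iff.1 hneg with h | h
        · exact Or.inr ⟨h.2.le, h.1.le⟩
        · exact Or.inl ⟨h.1.le, h.2.le⟩)
      rw [uIcc_of_le hcd] at hx
      refine h x ⟨lt_of_le_of_ne hx.1 ?_, lt_of_le_of_ne hx.2 ?_⟩ hx0
      · rintro rfl
        exact hc hx0
      · rintro rfl
        exact hd hx0

/-- Negative values are available in I before the smallest root and after the largest one, and
between two values of equal sign the number of roots is even. -/
theorem even_rootCount {p : ℝ[X]} {I : Set ℝ} (hI : I.OrdConnected)
    (hl : ∀ x ∈ I, ∃ c ∈ I, c < x ∧ p.eval c < 0) (hr : ∀ x ∈ I, ∃ d ∈ I, x < d ∧ p.eval d < 0) :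
    Even (rootCount p I) := by
  classical
  by_cases h : ∃ x ∈ I, p.eval x = 0
  · obtain ⟨x, hxI, hx0⟩ := h
    have hp : p ≠ 0 := by
      rintro rfl
      obtain ⟨c, -, -, hc⟩ := hl x hxI
      simp at hc
    set S := p.roots.toFinset.filter (· ∈ I)
    have hS : ∀ x, x ∈ S ↔ p.eval x = 0 ∧ x ∈ I := by
      intro x
      simp [S, hp]
    have hne : S.Nonempty := ⟨x, (hS x).2 ⟨hx0, hxI⟩⟩
    obtain ⟨c, hcI, hc, hcn⟩ := hl _ ((hS _).1 (S.min'_mem hne)).2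
    obtain ⟨d, hdI, hd, hdn⟩ := hr _ ((hS _).1 (S.max'_mem hne)).2
    have hcd : c < d := hc.trans ((S.min'_le _ (S.max'_mem hne)).trans_lt hd)
    have heq : rootCount p I = rootCount p (Ioo c d) := by
      refine rootCount_congr fun y hy => ⟨fun hyI => ?_, fun hyI => ?_⟩
      · have hyS := (hS y).2 ⟨hy, hyI⟩
        exact ⟨hc.trans_le (S.min'_le _ hyS), (S.le_max' _ hyS).trans_lt hd⟩
      · exact hI.out hcI hdI (Ioo_subset_Icc_self hyI)
    rw [heq]
    by_contra hodd
    have := eval_mul_eval_mul_neg_one_pow_rootCount_pos hcd.le p hcn.ne hdn.ne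
    rw [(Nat.not_even_iff_odd.1 hodd).neg_one_pow] at this
    nlinarith [mul_pos_of_neg_of_neg hcn hdn]
  · push Not at h
    rw [rootCount_eq_zero h]
    exact Even.zero

/-! ### Gaps between roots, and evenness of the count on them -/

/-- `I` is convex, free of roots of `p`, and each of its ends is a root of `p` or infinite. -/
structure IsRootGap (p : ℝ[X]) (I : Set ℝ) : Prop where
  ordConnected : I.OrdConnected
  ne_zero : ∀ x ∈ I, p.eval x ≠ 0
  left : ∀ x ∈ I, Iic x ⊆ I ∨ ∃ b < x, p.eval b = 0 ∧ Ioc b x ⊆ I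
  right : ∀ x ∈ I, Ici x ⊆ I ∨ ∃ b > x, p.eval b = 0 ∧ Ico x b ⊆ I

/-- Every point strictly between `z` and a point of `I` belongs to `I`, and so does `z` itself
unless it is an end of `I`. -/
def Touches (z : ℝ) (I : Set ℝ) : Prop :=
  ∀ x ∈ I, (x < z → Ico x z ⊆ I) ∧ (z < x → Ioc z x ⊆ I)

/-- Reflection x ↦ -x turns each statement about right ends into its counterpart for left ends.
Since φ(-x) has derivative -φ'(-x), the sign change `IsRootGap.of_neg_poly` is needed as well. -/
theorem IsRootGap.neg {p : ℝ[X]} {I : Set ℝ} (h : IsRootGap p I) :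
    IsRootGap (p.comp (-X)) (Neg.neg ⁻¹' I) where
  ordConnected := by
    refine ⟨fun x hx y hy z hz => h.ordConnected.out hy hx ⟨?_, ?_⟩⟩
    · exact neg_le_neg hz.2
    · exact neg_le_neg hz.1
  ne_zero x hx := by simpa using h.ne_zero (-x) hx
  left x hx := by
    rcases h.right (-x) hx with h1 | ⟨b, hb, hb0, h1⟩
    · exact Or.inl fun y hy => h1 (neg_le_neg (mem_Iic.1 hy))
    · refine Or.inr ⟨-b, by linarith, by simpa using hb0, fun y hy => h1 ⟨neg_le_neg hy.2, ?_⟩⟩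
      have := hy.1
      linarith
  right x hx := by
    rcases h.left (-x) hx with h1 | ⟨b, hb, hb0, h1⟩
    · exact Or.inl fun y hy => h1 (neg_le_neg (mem_Ici.1 hy))
    · refine Or.inr ⟨-b, by linarith, by simpa using hb0, fun y hy => h1 ⟨?_, neg_le_neg hy.1⟩⟩
      have := hy.2
      linarith

theorem IsRootGap.of_neg_poly {p : ℝ[X]} {I : Set ℝ} (h : IsRootGap (-p) I) : IsRootGap p I where
  ordConnected := h.ordConnected
  ne_zero x hx := by simpa using h.ne_zero x hx
  left x hx := by simpa using h.left x hx
  right x hx := by simpa using h.right x hx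

theorem IsRootGap.neg_derivative {φ : ℝ[X]} {I : Set ℝ} (h : IsRootGap (derivative φ) I) :
    IsRootGap (derivative (φ.comp (-X))) (Neg.neg ⁻¹' I) := by
  refine IsRootGap.of_neg_poly ?_
  rw [derivative_comp_neg_X, neg_neg]
  exact h.neg

theorem Touches.neg {z : ℝ} {I : Set ℝ} (h : Touches z I) : Touches (-z) (Neg.neg ⁻¹' I) := by
  intro x hx
  refine ⟨fun hxz y hy => (h (-x) hx).2 (by linarith) ⟨?_, neg_le_neg hy.1⟩,
    fun hxz y hy => (h (-x) hx).1 (by linarith) ⟨neg_le_neg hy.2, ?_⟩⟩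
  · have := hy.2
    linarith
  · have := hy.1
    linarith

theorem IsRootGap.exists_logWronskian_neg_right {p : ℝ[X]} (hp : 0 < p.natDegree) {I : Set ℝ}
    (h : IsRootGap p I) (x : ℝ) (hx : x ∈ I) :
    ∃ d ∈ I, x < d ∧ (logWronskian p).eval d < 0 := by
  rcases h.right x hx with h1 | ⟨b, hb, hb0, h1⟩
  · obtain ⟨d, hd, hxd⟩ := ((logWronskian_neg_atTop hp).and (eventually_gt_atTop x)).exists
    exact ⟨d, h1 hxd.le, hxd, hd⟩
  · have hp0 : p ≠ 0 := by
      rintro rfl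
      simp at hp
    have h2 : ∀ᶠ y in 𝓝[<] b, (logWronskian p).eval y < 0 :=
      nhdsWithin_mono b (fun y hy => ne_of_lt hy) (logWronskian_neg_near_root hp0 hb0)
    obtain ⟨d, hd, hxd⟩ := (h2.and (Ioo_mem_nhdsLT hb)).exists
    exact ⟨d, h1 ⟨hxd.1.le, hxd.2⟩, hxd.1, hd⟩

theorem IsRootGap.even_rootCount_logWronskian {p : ℝ[X]} (hp : 0 < p.natDegree) {I : Set ℝ}
    (h : IsRootGap p I) : Even (rootCount (logWronskian p) I) := by
  refine even_rootCount h.ordConnected (fun x hx => ?_) (h.exists_logWronskian_neg_right hp)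
  obtain ⟨d, hd, hxd, hdn⟩ := h.neg.exists_logWronskian_neg_right
    (by rwa [natDegree_comp_neg_X]) (-x) (by simpa using hx)
  refine ⟨-d, hd, by linarith, ?_⟩
  simpa [logWronskian_comp_neg] using hdn

/-- By the mean value theorem φ(x) = φ'(c)(x - z) with c in the gap, where φ' keeps its sign. -/
theorem Touches.eval_mul_pos {φ : ℝ[X]} {I : Set ℝ} (h : IsRootGap (derivative φ) I) {z : ℝ}
    (hz : φ.eval z = 0) (ht : Touches z I) {x : ℝ} (hx : x ∈ I) (hzx : z < x) :
    0 < φ.eval x * (derivative φ).eval x := by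
  obtain ⟨c, hc, hcd⟩ := exists_hasDerivAt_eq_slope (fun t => φ.eval t)
    (fun t => (derivative φ).eval t) hzx φ.continuous.continuousOn (fun t _ => φ.hasDerivAt t)
  have hcI : c ∈ I := (ht x hx).2 hzx (Ioo_subset_Ioc_self hc)
  have hpos := eval_mul_eval_mul_neg_one_pow_rootCount_pos hc.2.le (derivative φ)
    (h.ne_zero c hcI) (h.ne_zero x hx)
  rw [rootCount_eq_zero (fun y hy => h.ne_zero y (h.ordConnected.out hcI hx
    (Ioo_subset_Icc_self hy))), pow_zero, mul_one] at hpos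
  have hzx' : 0 < x - z := sub_pos.2 hzx
  have hval : φ.eval x = (derivative φ).eval c * (x - z) := by
    rw [hz, sub_zero, eq_div_iff hzx'.ne'] at hcd
    exact hcd.symm
  rw [hval]
  nlinarith [mul_pos hpos hzx']

theorem Touches.eval_mul_neg {φ : ℝ[X]} {I : Set ℝ} (h : IsRootGap (derivative φ) I) {z : ℝ}
    (hz : φ.eval z = 0) (ht : Touches z I) {x : ℝ} (hx : x ∈ I) (hxz : x < z) :
    φ.eval x * (derivative φ).eval x < 0 := by
  have := ht.neg.eval_mul_pos h.neg_derivative (by simpa using hz) (x := -x)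
    (by simpa using hx) (by linarith)
  simpa [derivative_comp_neg_X] using this

/-- The critical case is a right end b with φ'(b) = 0 ≠ φ(b). To the right of z the quotient φ'/φ is
positive, and it falls to 0 at b, so its derivative N/φ² is negative at points arbitrarily close to
b. -/
theorem Touches.exists_logWronskian_neg_right {φ : ℝ[X]} (hφ : 0 < φ.natDegree) {I : Set ℝ}
    (h : IsRootGap (derivative φ) I) {z : ℝ} (hz : φ.eval z = 0) (ht : Touches z I)
    (x : ℝ) (hx : x ∈ I) : ∃ d ∈ I, x < d ∧ (logWronskian φ).eval d < 0 := by
  rcases h.right x hx with h1 | ⟨b, hb, hb0, h1⟩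
  · obtain ⟨d, hd, hxd⟩ := ((logWronskian_neg_atTop hφ).and (eventually_gt_atTop x)).exists
    exact ⟨d, h1 hxd.le, hxd, hd⟩
  have hφ0 : φ ≠ 0 := by
    rintro rfl
    simp at hφ
  by_cases hφb : φ.eval b = 0
  · have h2 : ∀ᶠ y in 𝓝[<] b, (logWronskian φ).eval y < 0 :=
      nhdsWithin_mono b (fun y hy => ne_of_lt hy) (logWronskian_neg_near_root hφ0 hφb)
    obtain ⟨d, hd, hxd⟩ := (h2.and (Ioo_mem_nhdsLT hb)).exists
    exact ⟨d, h1 ⟨hxd.1.le, hxd.2⟩, hxd.1, hd⟩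
  -- If b were below z, touching would place the root b of φ' inside the gap; b = z is excluded by
  -- φ(b) ≠ 0.
  have hzb : z < b := by
    by_contra! hbz
    exact h.ne_zero b ((ht x hx).1 (hb.trans_le hbz) ⟨hb.le, lt_of_le_of_ne hbz (by
      rintro rfl
      exact hφb hz)⟩) hb0
  obtain ⟨y, hy, hyb⟩ := exists_between (max_lt hb hzb)
  obtain ⟨hxy, hzy⟩ := max_lt_iff.1 hy
  have hI : ∀ t ∈ Ico y b, t ∈ I := fun t ht => h1 ⟨hxy.le.trans ht.1, ht.2⟩
  have hpos : ∀ t ∈ Ico y b, 0 < φ.eval t * (derivative φ).eval t := fun t htt =>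
    ht.eval_mul_pos h hz (hI t htt) (hzy.trans_le htt.1)
  have hne : ∀ t ∈ Icc y b, φ.eval t ≠ 0 := by
    intro t htt
    rcases htt.2.lt_or_eq with h2 | rfl
    · exact left_ne_zero_of_mul (hpos t ⟨htt.1, h2⟩).ne'
    · exact hφb
  have hder : ∀ t ∈ Icc y b, HasDerivAt (fun t => (derivative φ).eval t / φ.eval t)
      ((logWronskian φ).eval t / φ.eval t ^ 2) t := by
    intro t htt
    have h0 : (logWronskian φ).eval t = (derivative (derivative φ)).eval t * φ.eval t -
        (derivative φ).eval t * (derivative φ).eval t := by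
      simp only [logWronskian, eval_sub, eval_mul, eval_pow]
      ring
    rw [h0]
    exact ((derivative φ).hasDerivAt t).div (φ.hasDerivAt t) (hne t htt)
  obtain ⟨c, hc, hcd⟩ := exists_hasDerivAt_eq_slope _ _ hyb
    (fun t htt => (hder t htt).continuousAt.continuousWithinAt)
    (fun t htt => hder t (Ioo_subset_Icc_self htt))
  refine ⟨c, hI c (Ioo_subset_Ico_self hc), hxy.trans hc.1, ?_⟩
  have hφc : 0 < φ.eval c ^ 2 := by
    have := hne c (Ioo_subset_Icc_self hc)
    positivity
  have hy0 : 0 < (derivative φ).eval y / φ.eval y := by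
    have h2 := hpos y ⟨le_rfl, hyb⟩
    rw [mul_comm] at h2
    exact div_pos_iff.2 (mul_pos_iff.1 h2)
  have : (logWronskian φ).eval c / φ.eval c ^ 2 < 0 := by
    rw [hcd, hb0, zero_div, zero_sub]
    exact div_neg_of_neg_of_pos (neg_neg_of_pos hy0) (sub_pos.2 hyb)
  rw [div_lt_iff₀ hφc, zero_mul] at this
  exact this

theorem Touches.even_rootCount_logWronskian {φ : ℝ[X]} (hφ : 0 < φ.natDegree) {I : Set ℝ}
    (h : IsRootGap (derivative φ) I) {z : ℝ} (hz : φ.eval z = 0) (ht : Touches z I) :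
    Even (rootCount (logWronskian φ) I) := by
  refine even_rootCount h.ordConnected (fun x hx => ?_)
    (ht.exists_logWronskian_neg_right hφ h hz)
  obtain ⟨d, hd, hxd, hdn⟩ := ht.neg.exists_logWronskian_neg_right
    (by rwa [natDegree_comp_neg_X]) h.neg_derivative (by simpa using hz) (-x) (by simpa using hx)
  refine ⟨-d, hd, by linarith, ?_⟩
  simpa [logWronskian_comp_neg] using hdn

/-! ### Upper bound in a single gap of `φ'` -/

/-- This is (N/φ')' = φN₁/φ'² without denominators, the link between Q and Q₁. -/
theorem wronskian_logWronskian_derivative (φ : ℝ[X]) :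
    derivative (logWronskian φ) * derivative φ - logWronskian φ * derivative (derivative φ) =
      φ * logWronskian (derivative φ) := by
  simp only [logWronskian, pow_two, derivative_sub, derivative_mul]
  ring

theorem rootCount_logWronskian_le {φ : ℝ[X]} (hφ : 1 < φ.natDegree) {I : Set ℝ}
    (hI : I.OrdConnected) (h : ∀ x ∈ I, (derivative φ).eval x ≠ 0) (h0 : ∀ x ∈ I, φ.eval x ≠ 0) :
    rootCount (logWronskian φ) I ≤ rootCount (logWronskian (derivative φ)) I + 1 := by
  have hne : φ * logWronskian (derivative φ) ≠ 0 := by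
    refine mul_ne_zero ?_ (logWronskian_ne_zero ?_)
    · rintro rfl
      simp at hφ
    · rw [natDegree_derivative]
      omega
  have := rootCount_le_rootCount_wronskian (p := logWronskian φ) hI h (by
    rwa [wronskian_logWronskian_derivative])
  rwa [wronskian_logWronskian_derivative, rootCount_mul hne, rootCount_eq_zero h0, zero_add]
    at this

theorem exists_isLeftNeighbour {φ : ℝ[X]} (hφ : derivative φ ≠ 0) (α : ℝ) :
    ∃ β, IsLeftNeighbour φ α β := by
  classical
  set S := (derivative φ).roots.toFinset.filter (· < α)
  have hS : ∀ x, x ∈ S ↔ (derivative φ).eval x = 0 ∧ x < α := by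
    intro x
    simp [S, hφ]
  rcases S.eq_empty_or_nonempty with h | h
  · refine ⟨⊥, fun x _ hx h0 => ?_, Or.inl rfl⟩
    simpa [h] using (hS x).2 ⟨h0, hx⟩
  · obtain ⟨h1, h2⟩ := (hS _).1 (S.max'_mem h)
    refine ⟨(S.max' h : ℝ), fun x hbx hx h0 => ?_, Or.inr ⟨_, rfl, h2, h1⟩⟩
    exact (EReal.coe_lt_coe_iff.1 hbx).not_ge (S.le_max' x ((hS x).2 ⟨h0, hx⟩))

theorem exists_isRightNeighbour {φ : ℝ[X]} (hφ : derivative φ ≠ 0) (α : ℝ) :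
    ∃ β, IsRightNeighbour φ α β := by
  classical
  set S := (derivative φ).roots.toFinset.filter (α < ·)
  have hS : ∀ x, x ∈ S ↔ (derivative φ).eval x = 0 ∧ α < x := by
    intro x
    simp [S, hφ]
  rcases S.eq_empty_or_nonempty with h | h
  · refine ⟨⊤, fun x hx _ h0 => ?_, Or.inl rfl⟩
    simpa [h] using (hS x).2 ⟨h0, hx⟩
  · obtain ⟨h1, h2⟩ := (hS _).1 (S.min'_mem h)
    refine ⟨(S.min' h : ℝ), fun x hx hbx h0 => ?_, Or.inr ⟨_, rfl, h2, h1⟩⟩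
    exact (EReal.coe_lt_coe_iff.1 hbx).not_ge (S.min'_le x ((hS x).2 ⟨h0, hx⟩))

/-- A touched gap cannot extend past the neighbouring zeros of φ', so each of its sides at z lies in
the corresponding interval of property A. If z is an end of the gap, one side is empty. -/
theorem HasPropertyAAt.logWronskian_ne_zero {φ : ℝ[X]} (hφ : derivative φ ≠ 0) {I : Set ℝ}
    (h : IsRootGap (derivative φ) I) {z : ℝ} (hz : φ.eval z = 0) (ht : Touches z I)
    (hA : HasPropertyAAt φ z) :
    (∀ x ∈ I, x < z → (logWronskian φ).eval x ≠ 0) ∨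
      (∀ x ∈ I, z < x → (logWronskian φ).eval x ≠ 0) := by
  classical
  have hφ0 : φ ≠ 0 := by
    rintro rfl
    simp at hφ
  have hmem : ∀ x, φ.eval x ≠ 0 → (logWronskian φ).eval x = 0 →
      x ∈ realZeros (logDerivDeriv φ) := by
    intro x h1 h2
    rw [realZeros_logDerivDeriv hφ0, Multiset.mem_filter,
      mem_roots (_root_.logWronskian_ne_zero (Nat.pos_of_ne_zero fun h3 => hφ ?_))]
    · exact ⟨h2, h1⟩
    · rw [eq_C_of_natDegree_eq_zero h3, derivative_C]
  obtain ⟨β₁, h₁⟩ := exists_isLeftNeighbour hφ z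
  obtain ⟨β₂, h₂⟩ := exists_isRightNeighbour hφ z
  refine (hA β₁ β₂ h₁ h₂).imp (fun h3 x hx hxz hx0 => ?_) (fun h3 x hx hzx hx0 => ?_)
  · refine h3 x (hmem x (left_ne_zero_of_mul (ht.eval_mul_neg h hz hx hxz).ne) hx0) ⟨?_, hxz⟩
    rcases h₁.2 with rfl | ⟨b, rfl, hb, hb0⟩
    · exact EReal.bot_lt_coe x
    · refine EReal.coe_lt_coe_iff.2 (lt_of_not_ge fun hxb => ?_)
      exact h.ne_zero b ((ht x hx).1 hxz ⟨hxb, hb⟩) hb0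
  · refine h3 x (hmem x (left_ne_zero_of_mul (ht.eval_mul_pos h hz hx hzx).ne') hx0) ⟨hzx, ?_⟩
    rcases h₂.2 with rfl | ⟨b, rfl, hb, hb0⟩
    · exact EReal.coe_lt_top x
    · refine EReal.coe_lt_coe_iff.2 (lt_of_not_ge fun hxb => ?_)
      exact h.ne_zero b ((ht x hx).2 hzx ⟨hb, hxb⟩) hb0

theorem Touches.rootCount_logWronskian_le {φ : ℝ[X]} (hφ : 1 < φ.natDegree) {I : Set ℝ}
    (h : IsRootGap (derivative φ) I) {z : ℝ} (hz : φ.eval z = 0) (ht : Touches z I)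
    (hA : HasPropertyAAt φ z) :
    rootCount (logWronskian φ) I ≤ rootCount (logWronskian (derivative φ)) I := by
  have hd : 0 < (derivative φ).natDegree := by
    rw [natDegree_derivative]
    omega
  have hd0 : derivative φ ≠ 0 := by
    intro h0
    simp [h0] at hd
  -- At z itself N equals -φ'(z)², which is nonzero inside a gap.
  have hzI : z ∈ I → (logWronskian φ).eval z ≠ 0 := by
    intro h1
    simp [logWronskian, hz, h.ne_zero z h1]
  have key : ∀ J : Set ℝ, J.OrdConnected → (∀ x ∈ I, x ∈ J → φ.eval x ≠ 0) →
      (∀ x ∈ I, (logWronskian φ).eval x = 0 → x ∈ J) →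
      rootCount (logWronskian φ) I ≤ rootCount (logWronskian (derivative φ)) I + 1 := by
    intro J hJ h1 h2
    calc rootCount (logWronskian φ) I = rootCount (logWronskian φ) (I ∩ J) :=
          rootCount_congr fun x hx => ⟨fun hxI => ⟨hxI, h2 x hxI hx⟩, fun hxI => hxI.1⟩
      _ ≤ rootCount (logWronskian (derivative φ)) (I ∩ J) + 1 :=
          _root_.rootCount_logWronskian_le hφ (h.ordConnected.inter hJ)
            (fun x hx => h.ne_zero x hx.1) (fun x hx => h1 x hx.1 hx.2)
      _ ≤ _ := Nat.add_le_add_right (rootCount_mono _ inter_subset_left) 1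
  have hle : rootCount (logWronskian φ) I ≤ rootCount (logWronskian (derivative φ)) I + 1 := by
    rcases hA.logWronskian_ne_zero hd0 h hz ht with h1 | h1
    · refine key (Ioi z) ordConnected_Ioi
        (fun x hx hxz => left_ne_zero_of_mul (ht.eval_mul_pos h hz hx hxz).ne')
        (fun x hx hx0 => ?_)
      rcases lt_trichotomy x z with h2 | rfl | h2
      · exact absurd hx0 (h1 x hx h2)
      · exact absurd hx0 (hzI hx)
      · exact h2
    · refine key (Iio z) ordConnected_Iio
        (fun x hx hxz => left_ne_zero_of_mul (ht.eval_mul_neg h hz hx hxz).ne)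
        (fun x hx hx0 => ?_)
      rcases lt_trichotomy x z with h2 | rfl | h2
      · exact h2
      · exact absurd hx0 (hzI hx)
      · exact absurd hx0 (h1 x hx h2)
  -- Two even numbers with a ≤ b + 1 satisfy a ≤ b.
  obtain ⟨a, ha⟩ := ht.even_rootCount_logWronskian (by omega) h hz
  obtain ⟨b, hb⟩ := h.even_rootCount_logWronskian hd
  omega

/-! ### Lower bound on an interval free of zeros of `φ` -/

/-- Since φ² tends to infinity, φ'/φ rises from 0 at b to a positive value further right, which
forces N > 0 somewhere. As N < 0 near +∞, it vanishes beyond b. -/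
theorem exists_logWronskian_eq_zero_right {φ : ℝ[X]} (hφ : 0 < φ.natDegree) {b : ℝ}
    (hb : (derivative φ).eval b = 0) (h : ∀ x ∈ Ici b, φ.eval x ≠ 0) :
    ∃ x > b, (logWronskian φ).eval x = 0 := by
  have hφ0 : φ ≠ 0 := by
    rintro rfl
    simp at hφ
  have hsq : Tendsto (fun x => (φ * φ).eval x) atTop atTop := by
    refine tendsto_atTop_of_leadingCoeff_nonneg _ ?_ ?_
    · rw [← natDegree_pos_iff_degree_pos, natDegree_mul hφ0 hφ0]
      omega
    · rw [leadingCoeff_mul]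
      exact mul_self_nonneg _
  obtain ⟨y, hy, hby⟩ := ((hsq.eventually_gt_atTop ((φ * φ).eval b)).and
    (eventually_gt_atTop b)).exists
  obtain ⟨c, hc, hcd⟩ := exists_hasDerivAt_eq_slope (fun t => (φ * φ).eval t)
    (fun t => (derivative (φ * φ)).eval t) hby (φ * φ).continuous.continuousOn
    (fun t _ => (φ * φ).hasDerivAt t)
  have hcpos : 0 < (derivative φ).eval c / φ.eval c := by
    have h1 : 0 < (derivative (φ * φ)).eval c := by
      rw [hcd]
      exact div_pos (sub_pos.2 hy) (sub_pos.2 hby)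
    rw [derivative_mul, eval_add, eval_mul, eval_mul] at h1
    have h2 : 0 < (derivative φ).eval c * φ.eval c := by linarith
    exact div_pos_iff.2 (mul_pos_iff.1 h2)
  have hder : ∀ t ∈ Icc b c, HasDerivAt (fun t => (derivative φ).eval t / φ.eval t)
      ((logWronskian φ).eval t / φ.eval t ^ 2) t := by
    intro t ht
    have h0 : (logWronskian φ).eval t = (derivative (derivative φ)).eval t * φ.eval t -
        (derivative φ).eval t * (derivative φ).eval t := by
      simp only [logWronskian, eval_sub, eval_mul, eval_pow]
      ring
    rw [h0]
    exact ((derivative φ).hasDerivAt t).div (φ.hasDerivAt t) (h t ht.1)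
  obtain ⟨d, hd, hdd⟩ := exists_hasDerivAt_eq_slope _ _ hc.1
    (fun t ht => (hder t ht).continuousAt.continuousWithinAt)
    (fun t ht => hder t (Ioo_subset_Icc_self ht))
  have hdpos : 0 < (logWronskian φ).eval d := by
    have h1 : 0 < (logWronskian φ).eval d / φ.eval d ^ 2 := by
      rw [hdd, hb, zero_div, sub_zero]
      exact div_pos hcpos (sub_pos.2 hc.1)
    have h2 : 0 < φ.eval d ^ 2 := by
      have := h d hd.1.le
      positivity
    exact (div_pos_iff_of_pos_right h2).1 h1
  obtain ⟨e, he, hde⟩ := ((logWronskian_neg_atTop hφ).and (eventually_gt_atTop d)).exists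
  obtain ⟨x, hx, hx0⟩ := intermediate_value_Icc' hde.le
    (f := fun t => (logWronskian φ).eval t) (logWronskian φ).continuous.continuousOn
    ⟨he.le, hdpos.le⟩
  exact ⟨x, hd.1.trans_le hx.1, hx0⟩

theorem exists_logWronskian_eq_zero_left {φ : ℝ[X]} (hφ : 0 < φ.natDegree) {b : ℝ}
    (hb : (derivative φ).eval b = 0) (h : ∀ x ∈ Iic b, φ.eval x ≠ 0) :
    ∃ x < b, (logWronskian φ).eval x = 0 := by
  obtain ⟨x, hx, hx0⟩ := exists_logWronskian_eq_zero_right (φ := φ.comp (-X)) (b := -b)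
    (by rwa [natDegree_comp_neg_X]) (by simpa [derivative_comp_neg_X] using hb) (by
      intro x hx
      have hx' : -x ∈ Iic b := by
        rw [mem_Iic]
        linarith [mem_Ici.1 hx]
      simpa using h (-x) hx')
  refine ⟨-x, by linarith, ?_⟩
  simpa [logWronskian_comp_neg] using hx0

/-- Rolle's theorem for `φ' / φ` on `I`, with an additional zero of the derivative beyond the
zeros of `φ'` for each infinite end of `I`. -/
theorem rootCount_derivative_le {φ : ℝ[X]} (hφ : 0 < φ.natDegree) {I : Set ℝ}
    (hI : I.OrdConnected) (h0 : ∀ x ∈ I, φ.eval x ≠ 0)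
    (hr : ∃ x ∈ I, (derivative φ).eval x = 0) {l u : ℕ} (hl1 : l ≤ 1) (hu1 : u ≤ 1)
    (hl : l = 1 → ∀ x ∈ I, Iic x ⊆ I) (hu : u = 1 → ∀ x ∈ I, Ici x ⊆ I) :
    rootCount (derivative φ) I + l + u ≤ rootCount (logWronskian φ) I + 1 := by
  classical
  have hd0 : derivative φ ≠ 0 := by
    intro h
    have := derivative_eq_zero.1 h
    omega
  have hN := logWronskian_ne_zero hφ
  set S := (derivative φ).roots.toFinset.filter (· ∈ I)
  have hS : ∀ x, x ∈ S ↔ (derivative φ).eval x = 0 ∧ x ∈ I := by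
    intro x
    simp [S, hd0]
  have hne : S.Nonempty := by
    obtain ⟨x, hx, hx0⟩ := hr
    exact ⟨x, (hS x).2 ⟨hx0, hx⟩⟩
  obtain ⟨ha0, haI⟩ := (hS _).1 (S.min'_mem hne)
  obtain ⟨hb0, hbI⟩ := (hS _).1 (S.max'_mem hne)
  set a := S.min' hne
  set b := S.max' hne
  have hsub : Icc a b ⊆ I := hI.out haI hbI
  have hW : derivative (derivative φ) * φ - derivative φ * derivative φ = logWronskian φ := by
    rw [logWronskian]
    ring
  -- Rolle is confined to the hull [a, b] of the zeros of φ', so that the zeros of N found beyond a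
  -- and b are not counted twice.
  have h1 : rootCount (derivative φ) I ≤ rootCount (logWronskian φ) (Icc a b) + 1 := by
    have h2 := rootCount_le_rootCount_wronskian (p := derivative φ) (q := φ) (I := Icc a b)
      ordConnected_Icc (fun x hx => h0 x (hsub hx)) (by rwa [hW])
    rw [hW] at h2
    refine le_trans (le_of_eq (rootCount_congr fun x hx => ⟨fun hxI => ?_, fun hx => hsub hx⟩)) h2
    exact ⟨S.min'_le x ((hS x).2 ⟨hx, hxI⟩), S.le_max' x ((hS x).2 ⟨hx, hxI⟩)⟩
  have hlow : l ≤ rootCount (logWronskian φ) (I ∩ Iio a) := by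
    interval_cases l
    · exact Nat.zero_le _
    · obtain ⟨x, hx, hx0⟩ := exists_logWronskian_eq_zero_left hφ ha0
        (fun x hx => h0 x (hl rfl a haI hx))
      exact rootCount_pos hN ⟨hl rfl a haI hx.le, hx⟩ hx0
  have hupp : u ≤ rootCount (logWronskian φ) (I ∩ Ioi b) := by
    interval_cases u
    · exact Nat.zero_le _
    · obtain ⟨x, hx, hx0⟩ := exists_logWronskian_eq_zero_right hφ hb0
        (fun x hx => h0 x (hu rfl b hbI hx))
      exact rootCount_pos hN ⟨hu rfl b hbI hx.le, hx⟩ hx0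
  have h3 : rootCount (logWronskian φ) (Icc a b) + rootCount (logWronskian φ) (I ∩ Ioi b) ≤
      rootCount (logWronskian φ) (I ∩ Ici a) := by
    refine rootCount_add_le _ (fun x hx => ⟨hsub hx, hx.1⟩)
      (fun x hx => ⟨hx.1, (S.min'_le_max' hne).trans (le_of_lt hx.2)⟩)
      (disjoint_left.2 fun x hx hx' => not_lt_of_ge hx.2 hx'.2)
  have h4 : rootCount (logWronskian φ) (I ∩ Ici a) + rootCount (logWronskian φ) (I ∩ Iio a) ≤
      rootCount (logWronskian φ) I := by
    refine rootCount_add_le _ inter_subset_left inter_subset_left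
      (disjoint_left.2 fun x hx hx' => not_lt_of_ge (mem_Ici.1 hx.2) (mem_Iio.1 hx'.2))
  omega

/-! ### Cutting the line into gaps indexed by rank -/

open Classical in
theorem sum_rootCount_eq {ι : Type*} (q : ℝ[X]) (T : Finset ι) (f : ι → Set ℝ) (J : Set ℝ)
    (hf : ∀ i ∈ T, f i ⊆ J) (hJ : ∀ x ∈ J, ∃ i ∈ T, x ∈ f i ∧ ∀ j ∈ T, x ∈ f j → j = i) :
    ∑ i ∈ T, rootCount q (f i) = rootCount q J := by
  simp only [rootCount_eq_sum, Finset.sum_filter]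
  rw [Finset.sum_comm]
  refine Finset.sum_congr rfl fun x _ => ?_
  split_ifs with hx
  · obtain ⟨i, hi, hxi, huniq⟩ := hJ x hx
    rw [Finset.sum_eq_single_of_mem i hi (fun j hj hji => if_neg fun h => hji (huniq j hj h)),
      if_pos hxi]
  · exact Finset.sum_eq_zero fun i hi => if_neg fun h => hx (hf i hi h)

theorem rootCount_union (q : ℝ[X]) {I J : Set ℝ} (h : Disjoint I J) :
    rootCount q (I ∪ J) = rootCount q I + rootCount q J := by
  have := sum_rootCount_eq q Finset.univ (fun b : Bool => cond b I J) (I ∪ J)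
    (by
      intro b _
      cases b
      · exact subset_union_right
      · exact subset_union_left)
    (by
      rintro x (hx | hx)
      · refine ⟨true, Finset.mem_univ _, hx, fun b _ hb => ?_⟩
        cases b
        · exact absurd hb (disjoint_left.1 h hx)
        · rfl
      · refine ⟨false, Finset.mem_univ _, hx, fun b _ hb => ?_⟩
        cases b
        · rfl
        · exact absurd hx (disjoint_left.1 h hb))
  simpa using this.symm

open Classical in
/-- The number of distinct roots of `p` smaller than `x`. -/
noncomputable def rootRank (p : ℝ[X]) (x : ℝ) : ℕ := (p.roots.toFinset.filter (· < x)).card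

open Classical in
/-- The number of distinct roots of `p` not larger than `x`. -/
noncomputable def rootRankLE (p : ℝ[X]) (x : ℝ) : ℕ := (p.roots.toFinset.filter (· ≤ x)).card

/-- The interval between the `j`-th root of `p` and the next one. -/
def rootGap (p : ℝ[X]) (j : ℕ) : Set ℝ := {x | p.eval x ≠ 0 ∧ rootRank p x = j}

theorem rootRank_lt {p : ℝ[X]} (hp : p ≠ 0) {x t y : ℝ} (ht : p.eval t = 0) (hxt : x ≤ t)
    (hty : t < y) : rootRank p x < rootRank p y := by
  classical
  refine Finset.card_lt_card (Finset.ssubset_iff_of_subset ?_ |>.2 ⟨t, ?_, ?_⟩)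
  · exact Finset.monotone_filter_right _ fun s _ hs => hs.trans_le (hxt.trans hty.le)
  · simp [hp, ht, hty]
  · simp [hxt]

theorem rootRankLE_le_rootRank {p : ℝ[X]} {x y : ℝ} (h : x < y) :
    rootRankLE p x ≤ rootRank p y := by
  classical
  exact Finset.card_le_card (Finset.monotone_filter_right _ fun s _ hs => hs.trans_lt h)

theorem rootRank_le_rootRankLE (p : ℝ[X]) (x : ℝ) : rootRank p x ≤ rootRankLE p x := by
  classical
  exact Finset.card_le_card (Finset.monotone_filter_right _ fun s _ hs => hs.le)

open Classical in
theorem rootRankLE_le_card (p : ℝ[X]) (x : ℝ) : rootRankLE p x ≤ p.roots.toFinset.card :=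
  Finset.card_filter_le _ _

open Classical in
theorem rootRankLE_eq {p : ℝ[X]} (hp : p ≠ 0) (x : ℝ) :
    rootRankLE p x = rootRank p x + if p.eval x = 0 then 1 else 0 := by
  rw [rootRankLE, rootRank]
  split_ifs with h
  · rw [← Finset.card_insert_of_notMem (s := p.roots.toFinset.filter (· < x)) (a := x) (by simp)]
    congr 1
    ext y
    simp only [Finset.mem_filter, Finset.mem_insert, Multiset.mem_toFinset, mem_roots hp,
      IsRoot.def, le_iff_lt_or_eq]
    constructor
    · rintro ⟨h1, h2 | h2⟩
      · exact Or.inr ⟨h1, h2⟩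
      · exact Or.inl h2
    · rintro (rfl | ⟨h1, h2⟩)
      · exact ⟨h, Or.inr rfl⟩
      · exact ⟨h1, Or.inl h2⟩
  · rw [add_zero]
    congr 1
    refine Finset.filter_congr fun y hy => ?_
    rw [le_iff_lt_or_eq, or_iff_left]
    rintro rfl
    simp [hp, h] at hy

theorem mem_rootGap_of_mem {p : ℝ[X]} {j : ℕ} {x y : ℝ} (hx : x ∈ rootGap p j)
    (h : ∀ t ∈ uIcc x y, p.eval t ≠ 0) : y ∈ rootGap p j := by
  classical
  refine ⟨h y right_mem_uIcc, ?_⟩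
  rw [← hx.2, rootRank, rootRank]
  congr 1
  refine Finset.filter_congr fun t ht => ?_
  have ht0 : p.eval t = 0 := isRoot_of_mem_roots (Multiset.mem_toFinset.1 ht)
  have hnot : t ∉ uIcc x y := fun h1 => h t h1 ht0
  rw [mem_uIcc] at hnot
  push Not at hnot
  constructor
  · intro h1
    by_contra! h2
    exact (hnot.1 h2).not_ge h1.le
  · intro h1
    by_contra! h2
    exact (hnot.2 h2).not_ge h1.le

theorem isRootGap_rootGap {p : ℝ[X]} (hp : p ≠ 0) (j : ℕ) : IsRootGap p (rootGap p j) where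
  ordConnected := by
    refine ⟨fun x hx y hy z hz => mem_rootGap_of_mem hx fun t ht ht0 => ?_⟩
    rw [uIcc_of_le hz.1] at ht
    have hty : t < y := lt_of_le_of_ne (ht.2.trans hz.2) (by
      rintro rfl
      exact hy.1 ht0)
    have := rootRank_lt hp ht0 ht.1 hty
    rw [hx.2, hy.2] at this
    exact this.false
  ne_zero x hx := hx.1
  left x hx := by
    classical
    set S := p.roots.toFinset.filter (· < x)
    have hS : ∀ t, t ∈ S ↔ p.eval t = 0 ∧ t < x := by
      intro t
      simp [S, hp]
    have hlt : ∀ t, p.eval t = 0 → t ≤ x → t ∈ S := fun t ht htx =>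
      (hS t).2 ⟨ht, lt_of_le_of_ne htx (by
        rintro rfl
        exact hx.1 ht)⟩
    rcases S.eq_empty_or_nonempty with h | h
    · refine Or.inl fun y hy => mem_rootGap_of_mem hx fun t ht ht0 => ?_
      rw [uIcc_of_ge hy] at ht
      simpa [h] using hlt t ht0 ht.2
    · obtain ⟨h1, h2⟩ := (hS _).1 (S.max'_mem h)
      refine Or.inr ⟨S.max' h, h2, h1, fun y hy => mem_rootGap_of_mem hx fun t ht ht0 => ?_⟩
      rw [uIcc_of_ge hy.2] at ht
      exact (hy.1.trans_le ht.1).not_ge (S.le_max' t (hlt t ht0 ht.2))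
  right x hx := by
    classical
    set S := p.roots.toFinset.filter (x < ·)
    have hS : ∀ t, t ∈ S ↔ p.eval t = 0 ∧ x < t := by
      intro t
      simp [S, hp]
    have hlt : ∀ t, p.eval t = 0 → x ≤ t → t ∈ S := fun t ht htx =>
      (hS t).2 ⟨ht, lt_of_le_of_ne htx (by
        rintro rfl
        exact hx.1 ht)⟩
    rcases S.eq_empty_or_nonempty with h | h
    · refine Or.inl fun y hy => mem_rootGap_of_mem hx fun t ht ht0 => ?_
      rw [uIcc_of_le hy] at ht
      simpa [h] using hlt t ht0 ht.1
    · obtain ⟨h1, h2⟩ := (hS _).1 (S.min'_mem h)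
      refine Or.inr ⟨S.min' h, h2, h1, fun y hy => mem_rootGap_of_mem hx fun t ht ht0 => ?_⟩
      rw [uIcc_of_le hy.1] at ht
      exact (ht.2.trans_lt hy.2).not_ge (S.min'_le t (hlt t ht0 ht.1))

/-- A point that is not a root has equal ranks and touches only its own gap; a root has ranks
differing by one and touches the two gaps it separates. -/
theorem touches_rootGap {p : ℝ[X]} (hp : p ≠ 0) {j : ℕ} {z : ℝ} (h1 : rootRank p z ≤ j)
    (h2 : j ≤ rootRankLE p z) : Touches z (rootGap p j) := by
  refine fun x hx => ⟨fun hxz y hy => mem_rootGap_of_mem hx fun t ht ht0 => ?_,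
    fun hzx y hy => mem_rootGap_of_mem hx fun t ht ht0 => ?_⟩
  · rw [uIcc_of_le hy.1] at ht
    have := rootRank_lt hp ht0 ht.1 (ht.2.trans_lt hy.2)
    rw [hx.2] at this
    omega
  · rw [uIcc_of_ge hy.2] at ht
    have h3 := rootRankLE_le_rootRank (p := p) (hy.1.trans_le ht.1)
    have h4 := rootRank_lt hp ht0 le_rfl (lt_of_le_of_ne ht.2 (by
      rintro rfl
      exact hx.1 ht0))
    rw [hx.2] at h4
    omega

open Classical in
theorem sum_rootCount_rootGap (p q : ℝ[X]) :
    ∑ j ∈ Finset.range (p.roots.toFinset.card + 1), rootCount q (rootGap p j) =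
      rootCount q {x | p.eval x ≠ 0} := by
  refine sum_rootCount_eq q _ _ _ (fun j _ x hx => hx.1) fun x hx => ?_
  refine ⟨rootRank p x, ?_, ⟨hx, rfl⟩, fun j _ hj => hj.2.symm⟩
  rw [Finset.mem_range, Nat.lt_succ_iff]
  exact Finset.card_filter_le _ _

/-! ### Evenness of Z(Q) and the global upper estimate -/

theorem numRealZeros_logDerivDeriv {φ : ℝ[X]} (hφ : φ ≠ 0) :
    numRealZeros (logDerivDeriv φ) = rootCount (logWronskian φ) {x | φ.eval x ≠ 0} := by
  classical
  rw [numRealZeros, realZeros_logDerivDeriv hφ, rootCount]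
  congr

theorem even_numRealZeros_logDerivDeriv {φ : ℝ[X]} (hφ : 0 < φ.natDegree) :
    Even (numRealZeros (logDerivDeriv φ)) := by
  have hφ0 : φ ≠ 0 := by
    rintro rfl
    simp at hφ
  rw [numRealZeros_logDerivDeriv hφ0, ← sum_rootCount_rootGap]
  exact Finset.even_sum _ fun j _ => (isRootGap_rootGap hφ0 j).even_rootCount_logWronskian hφ

/-- If φ' has order k + 1 at a, then φφ'' has order exactly k and φ'² has order 2k + 2. -/
theorem rootMultiplicity_logWronskian_of_derivative {φ : ℝ[X]} (hφ : derivative φ ≠ 0) {a : ℝ}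
    (ha : (derivative φ).eval a = 0) (h0 : φ.eval a ≠ 0) :
    (logWronskian φ).rootMultiplicity a + 1 = (derivative φ).rootMultiplicity a := by
  obtain ⟨u, hu, hdvd⟩ := exists_eq_pow_rootMultiplicity_mul_and_not_dvd (derivative φ) hφ a
  have hpos : 0 < (derivative φ).rootMultiplicity a := (rootMultiplicity_pos hφ).2 ha
  obtain ⟨k, hk⟩ : ∃ k, (derivative φ).rootMultiplicity a = k + 1 :=
    ⟨_, (Nat.succ_pred_eq_of_pos hpos).symm⟩
  have hua : u.eval a ≠ 0 := fun h => hdvd (dvd_iff_isRoot.2 h)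
  set v : ℝ[X] := φ * (C ((k : ℝ) + 1) * u + (X - C a) * derivative u) -
    (X - C a) ^ (k + 2) * u ^ 2 with hv
  have hN : logWronskian φ = (X - C a) ^ k * v := by
    rw [hk] at hu
    rw [logWronskian, hu, derivative_mul, derivative_X_sub_C_pow, hv, Nat.add_sub_cancel]
    push_cast
    simp only [map_add, map_one, map_natCast]
    ring
  have hva : v.eval a ≠ 0 := by
    have hk0 : (k : ℝ) + 1 ≠ 0 := by positivity
    simp [hv, h0, hk0, hua]
  have hv0 : v ≠ 0 := by
    intro h
    simp [h] at hva
  rw [hN, rootMultiplicity_mul (mul_ne_zero (pow_ne_zero _ (X_sub_C_ne_zero a)) hv0),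
    rootMultiplicity_X_sub_C_pow, rootMultiplicity_eq_zero (p := v) hva, hk]

open Classical in
theorem rootCount_logWronskian_add_card_le {φ : ℝ[X]} (hφ : derivative φ ≠ 0) :
    rootCount (logWronskian φ) {x | φ.eval x ≠ 0 ∧ (derivative φ).eval x = 0} +
        ((derivative φ).roots.toFinset.filter (fun x => φ.eval x ≠ 0)).card ≤
      rootCount (derivative φ) {x | φ.eval x ≠ 0} := by
  have hN : logWronskian φ ≠ 0 :=
    logWronskian_ne_zero (Nat.pos_of_ne_zero fun h => hφ (derivative_eq_zero.2 h))
  set T := (derivative φ).roots.toFinset.filter (fun x => φ.eval x ≠ 0)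
  have hT : ∀ x, x ∈ T ↔ (derivative φ).eval x = 0 ∧ φ.eval x ≠ 0 := by
    intro x
    simp [T, hφ]
  rw [rootCount_eq_sum, rootCount_eq_sum]
  calc _ ≤ ∑ x ∈ T, (logWronskian φ).rootMultiplicity x + T.card := by
        refine Nat.add_le_add_right (Finset.sum_le_sum_of_subset fun x hx => ?_) _
        simp only [Finset.mem_filter, mem_ofPred_eq] at hx
        exact (hT x).2 ⟨hx.2.2, hx.2.1⟩
    _ = ∑ x ∈ T, ((logWronskian φ).rootMultiplicity x + 1) := by simp [Finset.sum_add_distrib]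
    _ = ∑ x ∈ T, (derivative φ).rootMultiplicity x := by
        refine Finset.sum_congr rfl fun x hx => ?_
        obtain ⟨h1, h2⟩ := (hT x).1 hx
        exact rootMultiplicity_logWronskian_of_derivative hφ h1 h2
    _ = _ := Finset.sum_congr (by ext x; simp [T]) fun _ _ => rfl

open Classical in
/-- The number of distinct real zeros of `φ` that belong to the `j`-th interval between
consecutive zeros of `φ'` or are an end of it. -/
noncomputable def touchCount (φ : ℝ[X]) (j : ℕ) : ℕ :=
  (φ.roots.toFinset.filter
    (fun z => rootRank (derivative φ) z ≤ j ∧ j ≤ rootRankLE (derivative φ) z)).card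

/-- By Rolle, two zeros of φ have a zero of φ' strictly between them, so they cannot touch a common
gap. -/
theorem touchCount_le_one {φ : ℝ[X]} (hφ : derivative φ ≠ 0) (j : ℕ) : touchCount φ j ≤ 1 := by
  classical
  have key : ∀ a b : ℝ, a < b → φ.eval a = 0 → φ.eval b = 0 →
      j ≤ rootRankLE (derivative φ) a → rootRank (derivative φ) b ≤ j → False := by
    intro a b hab ha hb h1 h2
    obtain ⟨c, hc, hc0⟩ := exists_hasDerivAt_eq_zero hab φ.continuous.continuousOn
      (ha.trans hb.symm) (fun t _ => φ.hasDerivAt t)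
    have h3 := rootRankLE_le_rootRank (p := derivative φ) hc.1
    have h4 := rootRank_lt hφ hc0 le_rfl hc.2
    omega
  refine Finset.card_le_one.2 fun a ha b hb => ?_
  obtain ⟨ha0, ha1, ha2⟩ := Finset.mem_filter.1 ha
  obtain ⟨hb0, hb1, hb2⟩ := Finset.mem_filter.1 hb
  have ha0 : φ.eval a = 0 := isRoot_of_mem_roots (Multiset.mem_toFinset.1 ha0)
  have hb0 : φ.eval b = 0 := isRoot_of_mem_roots (Multiset.mem_toFinset.1 hb0)
  rcases lt_trichotomy a b with h | h | h
  · exact (key a b h ha0 hb0 ha2 hb1).elim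
  · exact h
  · exact (key b a h hb0 ha0 hb2 ha1).elim

open Classical in
-- Double counting of touching pairs: a simple zero of φ touches one gap, a multiple zero two.
theorem sum_touchCount {φ : ℝ[X]} (hφ : derivative φ ≠ 0) :
    ∑ j ∈ Finset.range ((derivative φ).roots.toFinset.card + 1), touchCount φ j =
      φ.roots.toFinset.card +
        ((derivative φ).roots.toFinset.filter (fun x => ¬ φ.eval x ≠ 0)).card := by
  have hφ0 : φ ≠ 0 := by
    rintro rfl
    simp at hφ
  have h1 : ∀ z ∈ φ.roots.toFinset,
      ((Finset.range ((derivative φ).roots.toFinset.card + 1)).filter (fun j =>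
        rootRank (derivative φ) z ≤ j ∧ j ≤ rootRankLE (derivative φ) z)).card =
      1 + if (derivative φ).eval z = 0 then 1 else 0 := by
    intro z _
    have h2 : (Finset.range ((derivative φ).roots.toFinset.card + 1)).filter (fun j =>
        rootRank (derivative φ) z ≤ j ∧ j ≤ rootRankLE (derivative φ) z) =
        Finset.Icc (rootRank (derivative φ) z) (rootRankLE (derivative φ) z) := by
      ext j
      have := rootRankLE_le_card (derivative φ) z
      simp only [Finset.mem_filter, Finset.mem_range, Finset.mem_Icc]
      omega
    rw [h2, Nat.card_Icc, rootRankLE_eq hφ]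
    omega
  simp only [touchCount]
  refine (Finset.sum_card_bipartiteAbove_eq_sum_card_bipartiteBelow (fun j z =>
    rootRank (derivative φ) z ≤ j ∧ j ≤ rootRankLE (derivative φ) z)).trans ?_
  refine (Finset.sum_congr rfl h1).trans ?_
  rw [Finset.sum_add_distrib, Finset.sum_const, smul_eq_mul, mul_one, ← Finset.card_filter]
  congr 2
  ext x
  simp [hφ0, hφ, and_comm]

theorem rootCount_rootGap_add_touchCount_le {φ : ℝ[X]} (hφ : 1 < φ.natDegree)
    (hA : HasPropertyA φ) (j : ℕ) :
    rootCount (logWronskian φ) (rootGap (derivative φ) j) + touchCount φ j ≤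
      rootCount (logWronskian (derivative φ)) (rootGap (derivative φ) j) + 1 := by
  classical
  have hφ0 : φ ≠ 0 := by
    rintro rfl
    simp at hφ
  have hd : derivative φ ≠ 0 := fun h => by
    have := derivative_eq_zero.1 h
    omega
  have hgap := isRootGap_rootGap hd j
  by_cases h : ∃ z, φ.eval z = 0 ∧ rootRank (derivative φ) z ≤ j ∧ j ≤ rootRankLE (derivative φ) z
  · obtain ⟨z, hz, h1, h2⟩ := h
    exact Nat.add_le_add ((touches_rootGap hd h1 h2).rootCount_logWronskian_le hφ hgap hz (hA z hz))
      (touchCount_le_one hd j)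
  · push Not at h
    have h0 : touchCount φ j = 0 := by
      refine Finset.card_eq_zero.2 (Finset.filter_eq_empty_iff.2 fun z hz hz' => ?_)
      exact (h z (isRoot_of_mem_roots (Multiset.mem_toFinset.1 hz)) hz'.1).not_ge hz'.2
    rw [h0, add_zero]
    refine rootCount_logWronskian_le hφ hgap.ordConnected hgap.ne_zero fun x hx hx0 => ?_
    exact (h x hx0 hx.2.le).not_ge (hx.2.ge.trans (rootRank_le_rootRankLE _ _))

open Classical in
-- There is one more gap than distinct zeros of φ'. Those where φ ≠ 0 are paid for by the drop of
-- one in multiplicity from φ' to N, those where φ = 0 by the second gap that a multiple zero of φ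
-- touches. Only the final 1 remains.
theorem numRealZeros_add_card_le {φ : ℝ[X]} (hφ : 1 < φ.natDegree) (hA : HasPropertyA φ) :
    numRealZeros (logDerivDeriv φ) + φ.roots.toFinset.card ≤
      numRealZeros (logDerivDeriv (derivative φ)) + 1 +
        rootCount (derivative φ) {x | φ.eval x ≠ 0} := by
  have hφ0 : φ ≠ 0 := by
    rintro rfl
    simp at hφ
  have hd : derivative φ ≠ 0 := fun h => by
    have := derivative_eq_zero.1 h
    omega
  have h1 := Finset.sum_le_sum fun j
    (_ : j ∈ Finset.range ((derivative φ).roots.toFinset.card + 1)) =>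
      rootCount_rootGap_add_touchCount_le hφ hA j
  rw [Finset.sum_add_distrib, Finset.sum_add_distrib, sum_rootCount_rootGap,
    sum_rootCount_rootGap, sum_touchCount hd, Finset.sum_const, Finset.card_range, smul_eq_mul,
    mul_one, ← numRealZeros_logDerivDeriv hd] at h1
  -- A zero of φ with φ' ≠ 0 is not a zero of N, so the condition φ' ≠ 0 brings in no zeros of N
  -- outside Q.
  have h2 : numRealZeros (logDerivDeriv φ) = rootCount (logWronskian φ)
      {x | (derivative φ).eval x ≠ 0} + rootCount (logWronskian φ)
        {x | φ.eval x ≠ 0 ∧ (derivative φ).eval x = 0} := by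
    rw [numRealZeros_logDerivDeriv hφ0, ← rootCount_union]
    · refine rootCount_congr fun x hx => ⟨fun h => ?_, ?_⟩
      · by_cases h3 : (derivative φ).eval x = 0
        · exact Or.inr ⟨h, h3⟩
        · exact Or.inl h3
      · rintro (h | h) h0
        · simp only [logWronskian, eval_sub, eval_mul, eval_pow, h0, zero_mul, zero_sub,
            neg_eq_zero] at hx
          exact h (pow_eq_zero_iff two_ne_zero |>.1 hx)
        · exact h.1 h0
    · exact disjoint_left.2 fun x hx hx' => hx hx'.2
  have h3 := rootCount_logWronskian_add_card_le hd
  have h4 := Finset.card_filter_add_card_filter_not (s := (derivative φ).roots.toFinset)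
    (fun x => φ.eval x ≠ 0)
  omega

/-! ### Extra zeros and the global lower estimates -/

theorem numExtraZeros_eq (φ : ℝ[X]) :
    numExtraZeros φ = ∑ ab ∈ consecutiveZeros φ, (rootCount (derivative φ) (Ioo ab.1 ab.2) - 1) +
      rootCount (derivative φ) {x | (∀ a ∈ φ.roots, x < a) ∨ (∀ a ∈ φ.roots, a < x)} := by
  simp only [numExtraZeros, rootCount, mem_Ioo, mem_ofPred_eq]

theorem mem_consecutiveZeros {φ : ℝ[X]} (hφ : φ ≠ 0) {a b : ℝ} :
    (a, b) ∈ consecutiveZeros φ ↔ φ.eval a = 0 ∧ φ.eval b = 0 ∧ a < b ∧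
      ∀ x ∈ Ioo a b, φ.eval x ≠ 0 := by
  classical
  simp only [consecutiveZeros, Finset.mem_filter, Finset.mem_product, Multiset.mem_toFinset,
    mem_roots hφ, IsRoot.def, mem_Ioo]
  constructor
  · rintro ⟨⟨ha, hb⟩, hab, h⟩
    exact ⟨ha, hb, hab, fun x hx h0 => h x h0 hx⟩
  · rintro ⟨ha, hb, hab, h⟩
    exact ⟨⟨ha, hb⟩, hab, fun x h0 hx => h x hx h0⟩

open Classical in
-- The left end determines the pair and is never the largest zero.
theorem card_consecutiveZeros_lt {φ : ℝ[X]} (hφ : φ ≠ 0) (h : ∃ x, φ.eval x = 0) :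
    (consecutiveZeros φ).card < φ.roots.toFinset.card := by
  have hne : φ.roots.toFinset.Nonempty := by
    obtain ⟨x, hx⟩ := h
    exact ⟨x, by simpa [hφ] using hx⟩
  have hle : (consecutiveZeros φ).card ≤
      (φ.roots.toFinset.erase (φ.roots.toFinset.max' hne)).card := by
    refine Finset.card_le_card_of_injOn Prod.fst ?_ ?_
    · rintro ⟨a, b⟩ hab
      obtain ⟨ha, hb, hlt, -⟩ := (mem_consecutiveZeros hφ).1 hab
      have hb' : b ∈ φ.roots.toFinset := by simpa [hφ] using hb
      exact Finset.mem_erase.2 ⟨(hlt.trans_le (Finset.le_max' _ _ hb')).ne, by simpa [hφ] using ha⟩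
    · rintro ⟨a, b⟩ hab ⟨a', b'⟩ hab' (rfl : a = a')
      obtain ⟨-, hb, hlt, h1⟩ := (mem_consecutiveZeros hφ).1 hab
      obtain ⟨-, hb', hlt', h1'⟩ := (mem_consecutiveZeros hφ).1 hab'
      rcases lt_trichotomy b b' with h2 | rfl | h2
      · exact absurd hb (h1' b ⟨hlt, h2⟩)
      · rfl
      · exact absurd hb' (h1 b' ⟨hlt', h2⟩)
  rw [Finset.card_erase_of_mem (Finset.max'_mem _ hne)] at hle
  have := Finset.card_pos.2 hne
  omega

theorem exists_mem_consecutiveZeros {φ : ℝ[X]} (hφ : φ ≠ 0) {x : ℝ} (hx : φ.eval x ≠ 0)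
    (hl : ∃ a < x, φ.eval a = 0) (hr : ∃ b > x, φ.eval b = 0) :
    ∃ ab ∈ consecutiveZeros φ, x ∈ Ioo ab.1 ab.2 := by
  classical
  set S := φ.roots.toFinset.filter (· < x)
  set T := φ.roots.toFinset.filter (x < ·)
  have hS : ∀ t, t ∈ S ↔ φ.eval t = 0 ∧ t < x := by
    intro t
    simp [S, hφ]
  have hT : ∀ t, t ∈ T ↔ φ.eval t = 0 ∧ x < t := by
    intro t
    simp [T, hφ]
  have hSn : S.Nonempty := hl.imp fun a ha => (hS a).2 ⟨ha.2, ha.1⟩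
  have hTn : T.Nonempty := hr.imp fun a ha => (hT a).2 ⟨ha.2, ha.1⟩
  obtain ⟨ha, hax⟩ := (hS _).1 (S.max'_mem hSn)
  obtain ⟨hb, hbx⟩ := (hT _).1 (T.min'_mem hTn)
  refine ⟨(S.max' hSn, T.min' hTn), (mem_consecutiveZeros hφ).2
    ⟨ha, hb, hax.trans hbx, fun t ht ht0 => ?_⟩, hax, hbx⟩
  rcases lt_trichotomy t x with h | rfl | h
  · exact ht.1.not_ge (S.le_max' t ((hS t).2 ⟨ht0, h⟩))
  · exact hx ht0
  · exact ht.2.not_ge (T.min'_le t ((hT t).2 ⟨ht0, h⟩))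

theorem rootCount_ne_zero_eq {φ : ℝ[X]} (hφ : φ ≠ 0) (q : ℝ[X]) :
    rootCount q {x | φ.eval x ≠ 0} =
      ∑ ab ∈ consecutiveZeros φ, rootCount q (Ioo ab.1 ab.2) +
        rootCount q {x | (∀ a ∈ φ.roots, x < a) ∨ (∀ a ∈ φ.roots, a < x)} := by
  set O := {x | (∀ a ∈ φ.roots, x < a) ∨ (∀ a ∈ φ.roots, a < x)} with hO
  have hOne : ∀ x ∈ O, φ.eval x ≠ 0 := by
    intro x hx h0
    have hm : x ∈ φ.roots := (mem_roots hφ).2 h0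
    rcases hx with h | h <;> exact (h x hm).false
  rw [sum_rootCount_eq q (consecutiveZeros φ) (fun ab => Ioo ab.1 ab.2)
    ({x | φ.eval x ≠ 0} \ O), ← rootCount_union q disjoint_sdiff_left,
    sdiff_union_of_subset
      (show O ⊆ {x | φ.eval x ≠ 0} from fun x hx => hOne x hx)]
  · rintro ⟨a, b⟩ hab x hx
    obtain ⟨ha, hb, -, h⟩ := (mem_consecutiveZeros hφ).1 hab
    refine ⟨h x hx, ?_⟩
    rintro (h1 | h1)
    · exact (h1 a ((mem_roots hφ).2 ha)).not_gt hx.1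
    · exact (h1 b ((mem_roots hφ).2 hb)).not_gt hx.2
  · rintro x ⟨hx, hxO⟩
    rw [hO, mem_ofPred_eq] at hxO
    push Not at hxO
    obtain ⟨⟨a, ha, hax⟩, b, hb, hbx⟩ := hxO
    have ha0 : φ.eval a = 0 := isRoot_of_mem_roots ha
    have hb0 : φ.eval b = 0 := isRoot_of_mem_roots hb
    obtain ⟨⟨c, d⟩, hcd, hxcd⟩ := exists_mem_consecutiveZeros hφ hx
      ⟨a, lt_of_le_of_ne hax (by rintro rfl; exact hx ha0), ha0⟩
      ⟨b, lt_of_le_of_ne hbx (by rintro rfl; exact hx hb0), hb0⟩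
    refine ⟨(c, d), hcd, hxcd, ?_⟩
    rintro ⟨c', d'⟩ hcd' hxcd'
    obtain ⟨hc, hd, -, h⟩ := (mem_consecutiveZeros hφ).1 hcd
    obtain ⟨hc', hd', -, h'⟩ := (mem_consecutiveZeros hφ).1 hcd'
    have e1 : c' = c := by
      rcases lt_trichotomy c' c with h1 | h1 | h1
      · exact absurd hc (h' c ⟨h1, hxcd.1.trans hxcd'.2⟩)
      · exact h1
      · exact absurd hc' (h c' ⟨h1, hxcd'.1.trans hxcd.2⟩)
    have e2 : d' = d := by
      rcases lt_trichotomy d' d with h1 | h1 | h1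
      · exact absurd hd' (h d' ⟨hxcd.1.trans hxcd'.2, h1⟩)
      · exact h1
      · exact absurd hd (h' d ⟨hxcd'.1.trans hxcd.2, h1⟩)
    rw [e1, e2]

/-- |φ| attains its minimum, so φ² has a critical point; there φφ' = 0 with φ ≠ 0. -/
theorem exists_derivative_eval_eq_zero {φ : ℝ[X]} (h : ∀ x, φ.eval x ≠ 0) :
    ∃ x, (derivative φ).eval x = 0 := by
  obtain ⟨x, hx⟩ := φ.exists_forall_norm_le
  have hmin : IsLocalMin (fun y => (φ * φ).eval y) x := by
    refine Eventually.of_forall fun y => ?_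
    simp only [eval_mul]
    exact abs_le_iff_mul_self_le.1 (hx y)
  have h1 := hmin.hasDerivAt_eq_zero ((φ * φ).hasDerivAt x)
  rw [derivative_mul, eval_add, eval_mul, eval_mul] at h1
  have h2 : (derivative φ).eval x * φ.eval x = 0 := by linarith
  exact ⟨x, (mul_eq_zero.1 h2).resolve_right (h x)⟩

theorem numExtraZeros_le {φ : ℝ[X]} (hφ : 0 < φ.natDegree) (h : ∃ x, φ.eval x = 0) :
    numExtraZeros φ ≤ numRealZeros (logDerivDeriv φ) := by
  have hφ0 : φ ≠ 0 := by
    rintro rfl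
    simp at hφ
  obtain ⟨z, hz⟩ := h
  have hz' : z ∈ φ.roots := (mem_roots hφ0).2 hz
  -- The real zero z separates the two outer half-lines; without it both sets would be the whole
  -- line.
  have hdisj : Disjoint {x | ∀ a ∈ φ.roots, x < a} {x | ∀ a ∈ φ.roots, a < x} :=
    disjoint_left.2 fun x hx hx' => (hx z hz').not_gt (hx' z hz')
  -- On a bounded interval (l = u = 0) Rolle's loss of one matches the zero that is not extra; on a
  -- half-line the additional zero at the infinite end cancels it.
  have key : ∀ (I : Set ℝ) (l u : ℕ), I.OrdConnected → (∀ x ∈ I, φ.eval x ≠ 0) → l + u ≤ 1 →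
      (l = 1 → ∀ x ∈ I, Iic x ⊆ I) → (u = 1 → ∀ x ∈ I, Ici x ⊆ I) →
      rootCount (derivative φ) I ≤ rootCount (logWronskian φ) I + 1 - (l + u) := by
    intro I l u hI h0 hlu hl hu
    by_cases hr : ∃ x ∈ I, (derivative φ).eval x = 0
    · have := rootCount_derivative_le hφ hI h0 hr (by omega) (by omega) hl hu
      omega
    · push Not at hr
      rw [rootCount_eq_zero hr]
      exact Nat.zero_le _
  rw [numExtraZeros_eq, numRealZeros_logDerivDeriv hφ0, rootCount_ne_zero_eq hφ0]
  refine Nat.add_le_add (Finset.sum_le_sum ?_) ?_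
  · rintro ⟨a, b⟩ hab
    obtain ⟨-, -, -, h0⟩ := (mem_consecutiveZeros hφ0).1 hab
    have := key (Ioo a b) 0 0 ordConnected_Ioo h0 (by simp) (by simp) (by simp)
    simp only
    omega
  · rw [ofPred_or, rootCount_union _ hdisj, rootCount_union _ hdisj]
    refine Nat.add_le_add (key _ 1 0 ?_ ?_ le_rfl ?_ (by simp)) (key _ 0 1 ?_ ?_ le_rfl (by simp) ?_)
    · exact ⟨fun x _ y hy t ht a ha => ht.2.trans_lt (hy a ha)⟩
    · exact fun x hx hx0 => (hx x ((mem_roots hφ0).2 hx0)).false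
    · exact fun _ x hx t ht a ha => (mem_Iic.1 ht).trans_lt (hx a ha)
    · exact ⟨fun x hx y _ t ht a ha => (hx a ha).trans_le ht.1⟩
    · exact fun x hx hx0 => (hx x ((mem_roots hφ0).2 hx0)).false
    · exact fun _ x hx t ht a ha => (hx a ha).trans_le (mem_Ici.1 ht)

theorem numExtraZeros_of_forall_ne_zero {φ : ℝ[X]} (h : ∀ x, φ.eval x ≠ 0) :
    numExtraZeros φ = rootCount (derivative φ) univ := by
  have h0 : φ.roots = 0 :=
    Multiset.eq_zero_of_forall_notMem fun x hx => h x (isRoot_of_mem_roots hx)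
  have h1 : consecutiveZeros φ = ∅ := by
    classical
    simp [consecutiveZeros, h0]
  rw [numExtraZeros_eq, h1, Finset.sum_empty, zero_add]
  congr 1
  simp [h0]

theorem numExtraZeros_add_one_le {φ : ℝ[X]} (hφ : 0 < φ.natDegree) (h : ∀ x, φ.eval x ≠ 0) :
    numExtraZeros φ + 1 ≤ numRealZeros (logDerivDeriv φ) := by
  have hφ0 : φ ≠ 0 := by
    rintro rfl
    simp at hφ
  obtain ⟨x, hx⟩ := exists_derivative_eval_eq_zero h
  have := rootCount_derivative_le hφ ordConnected_univ (fun x _ => h x) ⟨x, mem_univ x, hx⟩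
    (l := 1) (u := 1) le_rfl le_rfl (fun _ _ _ => subset_univ _) (fun _ _ _ => subset_univ _)
  have hu : {x | φ.eval x ≠ 0} = univ := eq_univ_of_forall h
  rw [numExtraZeros_of_forall_ne_zero h, numRealZeros_logDerivDeriv hφ0, hu]
  omega

theorem numRealZeros_logDerivDeriv_of_natDegree_eq_one {φ : ℝ[X]} (hφ : φ.natDegree = 1) :
    numRealZeros (logDerivDeriv φ) = 0 := by
  classical
  have hφ0 : φ ≠ 0 := by
    rintro rfl
    simp at hφ
  have h1 : (logWronskian φ).natDegree = 0 :=
    Nat.le_zero.1 (natDegree_logWronskian_le (k := 0) (by simpa using hφ))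
  have h2 : (logWronskian φ).roots = 0 := by
    rw [eq_C_of_natDegree_eq_zero h1, roots_C]
  rw [numRealZeros, realZeros_logDerivDeriv hφ0, h2]
  simp

end

/-! ### Rounding by parity -/

theorem mainTheorem5 (φ : ℝ[X]) (hφ : 0 < φ.natDegree) (hA : HasPropertyA φ) :
    ((∀ x : ℝ, φ.eval x ≠ 0) →
      2 * (numExtraZeros φ / 2) + 2 ≤ numRealZeros (logDerivDeriv φ) ∧
      numRealZeros (logDerivDeriv φ) ≤
        2 * (numExtraZeros φ / 2) + 2 + numRealZeros (logDerivDeriv (derivative φ))) ∧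
    ((∃ x : ℝ, φ.eval x = 0) →
      2 * (numExtraZeros φ / 2) ≤ numRealZeros (logDerivDeriv φ) ∧
      numRealZeros (logDerivDeriv φ) ≤
        2 * (numExtraZeros φ / 2) + numRealZeros (logDerivDeriv (derivative φ))) := by
  classical
  have hφ0 : φ ≠ 0 := by
    rintro rfl
    simp at hφ
  obtain ⟨m, hm⟩ := even_numRealZeros_logDerivDeriv hφ
  refine ⟨fun h => ⟨?_, ?_⟩, fun h => ⟨?_, ?_⟩⟩
  -- Z(Q) = m + m is even, so Z(Q) ≥ E + 1 rounds up to 2[E/2] + 2.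
  · have := numExtraZeros_add_one_le hφ h
    omega
  -- In degree 1 the polynomial N₁ vanishes identically and Rolle for N/φ' is unavailable, but Z(Q)
  -- = 0.
  · rcases (show φ.natDegree = 1 ∨ 1 < φ.natDegree by omega) with h1 | h1
    · rw [numRealZeros_logDerivDeriv_of_natDegree_eq_one h1]
      exact Nat.zero_le _
    · have h2 := numRealZeros_add_card_le h1 hA
      have hu : {x | φ.eval x ≠ 0} = Set.univ := Set.eq_univ_of_forall h
      rw [hu, ← numExtraZeros_of_forall_ne_zero h] at h2
      obtain ⟨n, hn⟩ := even_numRealZeros_logDerivDeriv (φ := derivative φ) (by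
        rw [natDegree_derivative]
        omega)
      omega
  · have := numExtraZeros_le hφ h
    omega
  · rcases (show φ.natDegree = 1 ∨ 1 < φ.natDegree by omega) with h1 | h1
    · rw [numRealZeros_logDerivDeriv_of_natDegree_eq_one h1]
      exact Nat.zero_le _
    · have h2 := numRealZeros_add_card_le h1 hA
      have h3 := card_consecutiveZeros_lt hφ0 h
      have h4 : rootCount (derivative φ) {x | φ.eval x ≠ 0} ≤
          numExtraZeros φ + (consecutiveZeros φ).card := by
        -- Truncated subtraction is harmless here, since n ≤ n - 1 + 1 also holds for n = 0.
        have h5 : ∑ ab ∈ consecutiveZeros φ, rootCount (derivative φ) (Set.Ioo ab.1 ab.2) ≤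
            ∑ ab ∈ consecutiveZeros φ, (rootCount (derivative φ) (Set.Ioo ab.1 ab.2) - 1 + 1) :=
          Finset.sum_le_sum fun ab _ => by omega
        rw [Finset.sum_add_distrib, Finset.sum_const, smul_eq_mul, mul_one] at h5
        rw [rootCount_ne_zero_eq hφ0, numExtraZeros_eq]
        omega
      obtain ⟨n, hn⟩ := even_numRealZeros_logDerivDeriv (φ := derivative φ) (by
        rw [natDegree_derivative]
        omega)
      omega
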